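/- **Setting.** Let $K\in[0,+\infty]$ and let $G:[0,K]\cap\mathbb R\to\mathbb R$ be Lipschitz continuous. Let $\mathcal R\subset[0,K]\cap\mathbb R$ be a closed set such that $G$ is affine on each connected component of $([0,K]\cap\mathbb R)\setminus\mathcal R$. Let $\lambda,\rho\in[0,K]\cap\mathbb R$ with $\lambda<\rho$. *Entropy solutions.* A bounded Borel function $u:\mathbb R\times(0,\infty)\to[0,K]\cap\mathbb R$ is an entropy solution of $\partial_t u+\partial_x[G(u)]=0$ if, for every continuous convex $\phi:[0,K]\cap\mathbb R\to\mathbb R$, with $\psi(u)=\int_0^u\phi'(v)G'(v)\,dv$, one has $\partial_t\phi(u)+\partial_x\psi(u)\le 0$ in the sense of distributions on $\mathbb R\times(0,\infty)$. It has initial datum $u_0$ if $u(\cdot,t)\to u_0$ in $L^1_{\rm loc}(\mathbb R)$ as $t\to0^+$. The Riemann datum is $R_{\lambda,\rho}(x)=\lambda\mathbf 1_{\{x<0\}}+\rho\mathbf 1_{\{x\ge0\}}$. *The function $h_c$.* Let $G_c$ be the lower convex envelope of $G$ on $[\lambda,\rho]$. Let $H_c$ be a nondecreasing function on $[\lambda,\rho]$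 whose one-sided limits $H_c(\alpha\pm0)$ are the one-sided derivatives of $G_c$. Put $v_*=H_c(\lambda+0)$ and $v^*=H_c(\rho-0)$. Let $h_c:[v_*,v^*]\to[\lambda,\rho]$ be a nondecreasing function such that, for $v\in[v_*,v^*]$ and $\alpha\in[\lambda,\rho]$, $\alpha<h_c(v)$ implies $H_c(\alpha)\le v$ and $\alpha>h_c(v)$ implies $H_c(\alpha)\ge v$. Extend it by $h_c(v)=\lambda$ for $v<v_*$ and $h_c(v)=\rho$ for $v>v^*$. Let $\Sigma_{low}(G)$ be the set of $v\in[v_*,v^*]$ such that $G_c$ is differentiable with derivative $v$ on some nonempty open subinterval of $[\lambda,\rho]$. For $v\in\mathbb R$ set $$\mathcal G_v(\lambda,\rho):=\inf\{G(r)-vr:\ r\in[\lambda,\rho]\}.$$ **Proposition.** The set $\Sigma_{low}(G)$ is at most countable, functions $H_c,h_c$ as above exist, and for every such choice: (i) For every $v\in\mathbb R\setminus\Sigma_{low}(G)$ the infimum $\mathcal G_v(\lambda,\rho)$ is attained at a unique point of $[\lambda,\rho]$, namely $h_c(v)$. The function $u(x,t):=h_c(x/t)$ is the entropy solution with initial datum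 $R_{\lambda,\rho}(\cdot)$: it is an entropy solution with this datum, and any other one equals it almost everywhere on $\mathbb R\times(0,\infty)$. It is denoted by $R_{\lambda,\rho}(x,t)$. (ii) If $\lambda\in\mathcal R$ and $\rho\in\mathcal R$, then for every $v\in\mathbb R$ the minimum is unchanged when restricted to $\mathcal R$, that is, $\mathcal G_v(\lambda,\rho)=\min\{G(r)-vr:\ r\in[\lambda,\rho]\cap\mathcal R\}$; moreover $R_{\lambda,\rho}(x,t)\in\mathcal R$ for almost every $(x,t)\in\mathbb R\times(0,\infty)$. (iii) For all $v,w\in\mathbb R$ and $t>0$, $$\int_v^w R_{\lambda,\rho}(x,t)\,dx=t\left[\mathcal G_{v/t}(\lambda,\rho)-\mathcal G_{w/t}(\lambda,\rho)\right].$$ -/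

import Mathlib

open Set Filter Topology MeasureTheory
open scoped NNReal ContDiff

noncomputable section

namespace ScalarLaw

/-- The set `[0,K] ∩ ℝ` of densities, where `K` is a number or `+∞`. -/
def densities (K : EReal) : Set ℝ := {r | 0 ≤ r ∧ (r : EReal) ≤ K}

/-- `R` is a closed set of densities such that `G` is affine on each connected component
(gap) of its complement in `[0,K] ∩ ℝ`. -/
structure IsAffineOnGaps (K : EReal) (G : ℝ → ℝ) (R : Set ℝ) : Prop where
  isClosed : IsClosed R
  subset : R ⊆ densities K
  affine : ∀ x ∈ densities K \ R, ∃ m c : ℝ,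
    ∀ y ∈ (densities K \ R).ordConnectedComponent x, G y = m * y + c

/-! ### Entropy solutions of `∂ₜ u + ∂ₓ G(u) = 0` on `ℝ × (0,∞)` -/

/-- The entropy flux `ψ(u) = ∫₀ᵘ φ'(v) G'(v) dv`. -/
def entropyFlux (G φ : ℝ → ℝ) (u : ℝ) : ℝ := ∫ v in (0 : ℝ)..u, deriv φ v * deriv G v

/-- The open half plane of points `(x, t)` with `t > 0`. -/
def halfPlane : Set (ℝ × ℝ) := univ ×ˢ Ioi 0

/-- Nonnegative smooth functions of `(x, t)` with compact support in `ℝ × (0,∞)`. -/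
structure IsTestFunction (θ : ℝ × ℝ → ℝ) : Prop where
  smooth : ContDiff ℝ ∞ θ
  compact : HasCompactSupport θ
  support : tsupport θ ⊆ halfPlane
  nonneg : ∀ p, 0 ≤ θ p

/-- `∂ₜ φ(u) + ∂ₓ ψ(u) ≤ 0` in the sense of distributions on `ℝ × (0,∞)`, where `ψ` is the
entropy flux of `φ`. -/
def IsDissipated (G φ : ℝ → ℝ) (u : ℝ → ℝ → ℝ) : Prop :=
  ∀ θ : ℝ × ℝ → ℝ, IsTestFunction θ →
    0 ≤ ∫ p in halfPlane,
      (φ (u p.1 p.2) * fderiv ℝ θ p (0, 1) + entropyFlux G φ (u p.1 p.2) * fderiv ℝ θ p (1, 0))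

/-- `u` is a (bounded, Borel, `[0,K] ∩ ℝ`-valued) entropy solution on `ℝ × (0,∞)`. Entropies are
the continuous convex functions on `[0,K] ∩ ℝ`. The values `u x t` with `t ≤ 0` play no role. -/
structure IsEntropySolution (K : EReal) (G : ℝ → ℝ) (u : ℝ → ℝ → ℝ) : Prop where
  borel : Measurable fun p : ℝ × Ioi (0 : ℝ) => u p.1 p.2
  mem : ∀ x t, 0 < t → u x t ∈ densities K
  bounded : ∃ M, ∀ x t, 0 < t → u x t ≤ M
  dissipative : ∀ φ : ℝ → ℝ, ConvexOn ℝ (densities K) φ → ContinuousOn φ (densities K) →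
    IsDissipated G φ u

/-- `u(·,t) → u₀` in `L¹_loc(ℝ)` as `t → 0+`. -/
def HasInitialDatum (u : ℝ → ℝ → ℝ) (u₀ : ℝ → ℝ) : Prop :=
  ∀ a b : ℝ, Tendsto (fun t => ∫ x in Icc a b, |u x t - u₀ x|) (𝓝[>] 0) (𝓝 0)

/-- The Riemann datum: `lam` for `x < 0`, `rho` for `x ≥ 0`. -/
def riemannDatum (lam rho x : ℝ) : ℝ := if x < 0 then lam else rho

/-- `u` is the entropy solution with initial datum `u₀`: it is one, and every other one agrees with
it almost everywhere on `ℝ × (0,∞)`. -/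
def IsTheEntropySolution (K : EReal) (G : ℝ → ℝ) (u₀ : ℝ → ℝ) (u : ℝ → ℝ → ℝ) : Prop :=
  (IsEntropySolution K G u ∧ HasInitialDatum u u₀) ∧
    ∀ w : ℝ → ℝ → ℝ, IsEntropySolution K G w → HasInitialDatum w u₀ →
      ∀ᵐ p ∂((volume : Measure (ℝ × ℝ)).restrict halfPlane), w p.1 p.2 = u p.1 p.2

/-! ### The convex envelope and the function `h_c` -/

/-- The lower convex envelope of `G` on `[lam, rho]`, i.e. the largest convex function on
`[lam, rho]` lying below `G`. Only its values on `[lam, rho]` matter. -/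
def lowerEnvelope (G : ℝ → ℝ) (lam rho x : ℝ) : ℝ :=
  sSup {y | ∃ f : ℝ → ℝ, ConvexOn ℝ (Icc lam rho) f ∧ (∀ r ∈ Icc lam rho, f r ≤ G r) ∧ y = f x}

/-- `v_* = H_c(lam + 0)`, the right-hand derivative of the envelope at `lam`. -/
def vLow (G : ℝ → ℝ) (lam rho : ℝ) : ℝ :=
  derivWithin (lowerEnvelope G lam rho) (Icc lam rho) lam

/-- `v^* = H_c(rho - 0)`, the left-hand derivative of the envelope at `rho`. -/
def vHigh (G : ℝ → ℝ) (lam rho : ℝ) : ℝ :=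
  derivWithin (lowerEnvelope G lam rho) (Icc lam rho) rho

/-- `Σ_low(G)`: the slopes of the envelope on nonempty open subintervals of `[lam, rho]`. -/
def sigmaLow (G : ℝ → ℝ) (lam rho : ℝ) : Set ℝ :=
  {v | v ∈ Icc (vLow G lam rho) (vHigh G lam rho) ∧ ∃ a b : ℝ, a < b ∧ Ioo a b ⊆ Icc lam rho ∧
    ∀ x ∈ Ioo a b, HasDerivAt (lowerEnvelope G lam rho) v x}

/-- `H` is a possible choice of `H_c`: it is nondecreasing on `[lam, rho]` and its one-sided limits
are the one-sided derivatives of the envelope. -/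
structure IsHc (G : ℝ → ℝ) (lam rho : ℝ) (H : ℝ → ℝ) : Prop where
  mono : MonotoneOn H (Icc lam rho)
  right : ∀ α ∈ Ico lam rho, ∃ l : ℝ, Tendsto H (𝓝[>] α) (𝓝 l) ∧
    HasDerivWithinAt (lowerEnvelope G lam rho) l (Ioi α) α
  left : ∀ α ∈ Ioc lam rho, ∃ l : ℝ, Tendsto H (𝓝[<] α) (𝓝 l) ∧
    HasDerivWithinAt (lowerEnvelope G lam rho) l (Iio α) α

/-- `h` is a possible choice of `h_c`: a nondecreasing generalized inverse of some choice `H` of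
`H_c` on `[v_*, v^*]`, with values in `[lam, rho]`, extended by `lam` on the left and by `rho` on
the right. -/
structure IshcOf (G : ℝ → ℝ) (lam rho : ℝ) (H h : ℝ → ℝ) : Prop where
  isHc : IsHc G lam rho H
  mono : MonotoneOn h (Icc (vLow G lam rho) (vHigh G lam rho))
  mem : ∀ v ∈ Icc (vLow G lam rho) (vHigh G lam rho), h v ∈ Icc lam rho
  below : ∀ v ∈ Icc (vLow G lam rho) (vHigh G lam rho), ∀ α ∈ Icc lam rho, α < h v → H α ≤ v
  above : ∀ v ∈ Icc (vLow G lam rho) (vHigh G lam rho), ∀ α ∈ Icc lam rho, h v < α → v ≤ H α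
  eq_lam : ∀ v, v < vLow G lam rho → h v = lam
  eq_rho : ∀ v, vHigh G lam rho < v → h v = rho

/-- `h` is a possible choice of `h_c`. -/
def Ishc (G : ℝ → ℝ) (lam rho : ℝ) (h : ℝ → ℝ) : Prop := ∃ H, IshcOf G lam rho H h

/-- `𝒢_v(lam, rho) = inf {G(r) - v r : r ∈ [lam, rho]}`. -/
def curlyG (G : ℝ → ℝ) (v lam rho : ℝ) : ℝ := sInf ((fun r => G r - v * r) '' Icc lam rho)

end ScalarLaw

end

/-!
The Riemann problem is solved, and its solution shown to be unique, without doubling of variables: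
both follow from one localization argument along the rays `x / t = ξ`.

For a slope `ξ` let `κ ξ` be a minimizer of `r ↦ G r - ξ * r` on `[lam, rho]`. Minimizers are
nondecreasing in `ξ`, they touch the lower convex envelope of `G`, and off the countable set
`sigmaLow` the minimizer is unique and equal to `h ξ`, because an admissible `h` is a generalized
inverse of the slope of the envelope (`Ishc.isTiltMin_envelope`, `mem_sigmaLow_of_two_minimizers`,
`Ishc.isTiltMin_iff`). A minimizer in a gap of `R` slides along the affine piece of `G` to the end
of the gap (`exists_isTiltMin_mem`), and the concave function `ξ ↦ curlyG G ξ lam rho` has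
derivative `-κ` off a countable set, which is the mass formula (`integral_selection`).

For the conservation law, take a family of pairs `A k`, `B k` that each satisfy the entropy
inequality, test with `θ` times a partition of unity in the variable `x / t`, using the parameter
`k = κ ξ` near the ray of slope `ξ`, and sum. What is left over are the jumps of `B - ξ A` between
neighbouring parameters. If a jump from `κ ξ₁` to `κ ξ₂` is at most `(ξ₂ - ξ₁)` times the increment
of a monotone function, the jumps are negligible as the partition is refined, and the pair selected
by `k = κ (x / t)` satisfies the entropy inequality (`superposition`). Both uses rest on the fact
that neighbouring values are minimizers for neighbouring slopes:

* `A k = φ k`, `B k = ψ k`, constant in `(x, t)`, shows that the fan dissipates the entropy `φ`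
  (`fan_dissipates`); the jump inequality is `integral_deriv_mul_le`.
* `A k = |w - k|` and the corresponding Kruzhkov flux, for another entropy solution `w`, gives the
  Kato inequality for `|w - h (x / t)|` (`kato_fan`); the jump inequality is `kruzhkov_jump_le`.

The Kato inequality and finite speed of propagation (`ae_eq_zero_of_dissipated`) give uniqueness.
-/

noncomputable section

namespace ScalarLaw

/-! ### Minimizers of the tilted flux -/

/-- `r` minimizes the tilted function `s ↦ G s - v * s` over `[lam, rho]`. -/
def IsTiltMin (G : ℝ → ℝ) (lam rho v r : ℝ) : Prop :=
  r ∈ Icc lam rho ∧ ∀ s ∈ Icc lam rho, G r - v * r ≤ G s - v * s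

theorem exists_isTiltMin {G : ℝ → ℝ} {lam rho : ℝ} (hle : lam ≤ rho)
    (hG : ContinuousOn G (Icc lam rho)) (v : ℝ) : ∃ r, IsTiltMin G lam rho v r := by
  obtain ⟨r, hr, hmin⟩ := isCompact_Icc.exists_isMinOn (nonempty_Icc.2 hle)
    (hG.sub (f := G) (g := fun s => v * s) (by fun_prop))
  exact ⟨r, hr, fun s hs => hmin hs⟩

theorem IsTiltMin.curlyG_eq {G : ℝ → ℝ} {lam rho v r : ℝ} (h : IsTiltMin G lam rho v r) :
    curlyG G v lam rho = G r - v * r := by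
  have : IsLeast ((fun s => G s - v * s) '' Icc lam rho) (G r - v * r) :=
    ⟨⟨r, h.1, rfl⟩, by rintro _ ⟨s, hs, rfl⟩; exact h.2 s hs⟩
  exact this.csInf_eq

theorem IsTiltMin.le_of_lt {G : ℝ → ℝ} {lam rho v w r s : ℝ} (hr : IsTiltMin G lam rho v r)
    (hs : IsTiltMin G lam rho w s) (hvw : v < w) : r ≤ s := by
  have h1 := hr.2 s hs.1
  have h2 := hs.2 r hr.1
  by_contra! h
  nlinarith [mul_pos (sub_pos.2 hvw) (sub_pos.2 h)]

theorem abs_sub_le_of_lipschitzOnWith {G : ℝ → ℝ} {L : ℝ≥0} {s : Set ℝ}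
    (hG : LipschitzOnWith L G s) {x y : ℝ} (hx : x ∈ s) (hy : y ∈ s) :
    |G x - G y| ≤ L * |x - y| := by
  simpa [Real.dist_eq] using hG.dist_le_mul x hx y hy

theorem isTiltMin_left {G : ℝ → ℝ} {L : ℝ≥0} {lam rho v : ℝ} (hle : lam ≤ rho)
    (hG : LipschitzOnWith L G (Icc lam rho)) (hv : v ≤ -L) : IsTiltMin G lam rho v lam := by
  refine ⟨left_mem_Icc.2 hle, fun s hs => ?_⟩
  have h := abs_le.1 (abs_sub_le_of_lipschitzOnWith hG hs (left_mem_Icc.2 hle))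
  rw [abs_of_nonneg (sub_nonneg.2 hs.1)] at h
  nlinarith [h.1, mul_nonneg (sub_nonneg.2 hv) (sub_nonneg.2 hs.1)]

theorem isTiltMin_right {G : ℝ → ℝ} {L : ℝ≥0} {lam rho v : ℝ} (hle : lam ≤ rho)
    (hG : LipschitzOnWith L G (Icc lam rho)) (hv : L ≤ v) : IsTiltMin G lam rho v rho := by
  refine ⟨right_mem_Icc.2 hle, fun s hs => ?_⟩
  have h := abs_le.1 (abs_sub_le_of_lipschitzOnWith hG (right_mem_Icc.2 hle) hs)
  rw [abs_of_nonneg (sub_nonneg.2 hs.2)] at h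
  nlinarith [h.2, mul_nonneg (sub_nonneg.2 hv) (sub_nonneg.2 hs.2)]

/-! ### The lower convex envelope -/

theorem bddAbove_envelope_set {G : ℝ → ℝ} {lam rho x : ℝ} (hx : x ∈ Icc lam rho) :
    BddAbove {y | ∃ f : ℝ → ℝ, ConvexOn ℝ (Icc lam rho) f ∧
      (∀ r ∈ Icc lam rho, f r ≤ G r) ∧ y = f x} :=
  ⟨G x, by rintro _ ⟨f, -, hf, rfl⟩; exact hf x hx⟩

theorem le_lowerEnvelope {G f : ℝ → ℝ} {lam rho x : ℝ} (hx : x ∈ Icc lam rho)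
    (hf : ConvexOn ℝ (Icc lam rho) f) (hle : ∀ r ∈ Icc lam rho, f r ≤ G r) :
    f x ≤ lowerEnvelope G lam rho x :=
  le_csSup (bddAbove_envelope_set hx) ⟨f, hf, hle, rfl⟩

theorem convexOn_affine (c v lam rho : ℝ) : ConvexOn ℝ (Icc lam rho) fun x => c + v * x := by
  refine ⟨convex_Icc _ _, fun x _ y _ a b _ _ hab => le_of_eq ?_⟩
  simp only [smul_eq_mul]
  linear_combination (-c) * hab

/-- A tilted minimum gives the affine minorant `G r + v * (x - r)`. -/
theorem IsTiltMin.affine_le_lowerEnvelope {G : ℝ → ℝ} {lam rho v r x : ℝ}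
    (h : IsTiltMin G lam rho v r) (hx : x ∈ Icc lam rho) :
    G r - v * r + v * x ≤ lowerEnvelope G lam rho x :=
  le_lowerEnvelope hx (convexOn_affine _ _ _ _) fun s hs => by linarith [h.2 s hs]

section Envelope

variable {G : ℝ → ℝ} {L : ℝ≥0} {lam rho : ℝ}

theorem nonempty_envelope_set (hle : lam ≤ rho) (hG : LipschitzOnWith L G (Icc lam rho)) (x : ℝ) :
    {y | ∃ f : ℝ → ℝ, ConvexOn ℝ (Icc lam rho) f ∧
      (∀ r ∈ Icc lam rho, f r ≤ G r) ∧ y = f x}.Nonempty := by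
  obtain ⟨r, hr⟩ := exists_isTiltMin hle hG.continuousOn 0
  exact ⟨_, _, convexOn_affine (G r - 0 * r) 0 _ _, fun s hs => by linarith [hr.2 s hs], rfl⟩

theorem lowerEnvelope_le (hle : lam ≤ rho) (hG : LipschitzOnWith L G (Icc lam rho)) {x : ℝ}
    (hx : x ∈ Icc lam rho) : lowerEnvelope G lam rho x ≤ G x :=
  csSup_le (nonempty_envelope_set hle hG x) (by rintro _ ⟨f, -, hf, rfl⟩; exact hf x hx)

theorem convexOn_lowerEnvelope (hle : lam ≤ rho) (hG : LipschitzOnWith L G (Icc lam rho)) :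
    ConvexOn ℝ (Icc lam rho) (lowerEnvelope G lam rho) := by
  refine ⟨convex_Icc _ _, fun x hx y hy a b ha hb hab => ?_⟩
  refine csSup_le (nonempty_envelope_set hle hG _) ?_
  rintro _ ⟨f, hf, hfG, rfl⟩
  refine (hf.2 hx hy ha hb hab).trans ?_
  simp only [smul_eq_mul]
  gcongr
  · exact le_lowerEnvelope hx hf hfG
  · exact le_lowerEnvelope hy hf hfG

/-- A minimizer of the tilted flux is a contact point with the envelope, and it minimizes the
tilted envelope as well. -/
theorem IsTiltMin.envelope (hle : lam ≤ rho) (hG : LipschitzOnWith L G (Icc lam rho)) {v r : ℝ}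
    (h : IsTiltMin G lam rho v r) :
    lowerEnvelope G lam rho r = G r ∧ IsTiltMin (lowerEnvelope G lam rho) lam rho v r := by
  have h1 := h.affine_le_lowerEnvelope h.1
  have h2 := lowerEnvelope_le hle hG h.1
  exact ⟨by linarith, h.1, fun s hs => by linarith [h.affine_le_lowerEnvelope hs]⟩

theorem slope_le_iff {E : ℝ → ℝ} {x y v : ℝ} (hxy : x < y) :
    slope E x y ≤ v ↔ E y - v * y ≤ E x - v * x := by
  rw [slope_def_field, div_le_iff₀ (sub_pos.2 hxy)]
  constructor <;> intro h <;> linarith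

theorem le_slope_iff {E : ℝ → ℝ} {x y v : ℝ} (hxy : x < y) :
    v ≤ slope E x y ↔ E x - v * x ≤ E y - v * y := by
  rw [slope_def_field, le_div_iff₀ (sub_pos.2 hxy)]
  constructor <;> intro h <;> linarith

theorem slope_lowerEnvelope_mem (hle : lam ≤ rho) (hG : LipschitzOnWith L G (Icc lam rho))
    {x y : ℝ} (hx : x ∈ Icc lam rho) (hy : y ∈ Icc lam rho) (hxy : x < y) :
    slope (lowerEnvelope G lam rho) x y ∈ Icc (-(L : ℝ)) L := by
  have hE := convexOn_lowerEnvelope hle hG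
  have hl := ((isTiltMin_left hle hG le_rfl).envelope hle hG).2
  have hr := ((isTiltMin_right hle hG le_rfl).envelope hle hG).2
  have hlam := left_mem_Icc.2 hle
  have hrho := right_mem_Icc.2 hle
  constructor
  · rcases hx.1.eq_or_lt with rfl | h
    · exact (le_slope_iff hxy).2 (hl.2 y hy)
    · have h1 := (le_slope_iff h).2 (hl.2 x hx)
      have h2 := hE.slope_mono_adjacent hlam hy h hxy
      rw [← slope_def_field, ← slope_def_field] at h2
      exact h1.trans h2
  · rcases hy.2.eq_or_lt with rfl | h
    · exact (slope_le_iff hxy).2 (hr.2 x hx)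
    · have h1 := (slope_le_iff h).2 (hr.2 y hy)
      have h2 := hE.slope_mono_adjacent hx hrho hxy h
      rw [← slope_def_field, ← slope_def_field] at h2
      exact h2.trans h1

end Envelope

/-! ### One-sided derivatives of convex functions on a closed interval -/

section OneSided

variable {E : ℝ → ℝ} {lam rho : ℝ}

/-- A convex function whose secants are bounded below has right derivatives everywhere, the left
endpoint of its interval included. -/
theorem exists_hasDerivWithinAt_Ioi (hE : ConvexOn ℝ (Icc lam rho) E) {C x : ℝ}
    (hx : x ∈ Ico lam rho) (hC : ∀ y ∈ Ioc x rho, C ≤ slope E x y) :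
    ∃ l, HasDerivWithinAt E l (Ioi x) x := by
  have hsub : Ioo x rho ⊆ {y ∈ Icc lam rho | x < y} := fun y hy =>
    ⟨⟨hx.1.trans hy.1.le, hy.2.le⟩, hy.1⟩
  refine ⟨_, (hasDerivWithinAt_iff_tendsto_slope' self_notMem_Ioi).2
    (((hE.monotoneOn_slope_gt ⟨hx.1, hx.2.le⟩).mono hsub).tendsto_nhdsWithin_Ioo_right
      (nonempty_Ioo.2 hx.2) ⟨C, ?_⟩)⟩
  rintro _ ⟨y, hy, rfl⟩
  exact hC y ⟨hy.1, hy.2.le⟩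

theorem exists_hasDerivWithinAt_Iio (hE : ConvexOn ℝ (Icc lam rho) E) {C x : ℝ}
    (hx : x ∈ Ioc lam rho) (hC : ∀ y ∈ Ico lam x, slope E y x ≤ C) :
    ∃ l, HasDerivWithinAt E l (Iio x) x := by
  have hsub : Ioo lam x ⊆ {y ∈ Icc lam rho | y < x} := fun y hy =>
    ⟨⟨hy.1.le, hy.2.le.trans hx.2⟩, hy.2⟩
  refine ⟨_, (hasDerivWithinAt_iff_tendsto_slope' self_notMem_Iio).2
    (((hE.monotoneOn_slope_lt ⟨hx.1.le, hx.2⟩).mono hsub).tendsto_nhdsWithin_Ioo_left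
      (nonempty_Ioo.2 hx.1) ⟨C, ?_⟩)⟩
  rintro _ ⟨y, hy, rfl⟩
  rw [slope_comm]
  exact hC y ⟨hy.1.le, hy.2⟩

/-- Right derivatives of a convex function are right continuous. -/
theorem tendsto_rightDeriv_nhdsGT (hE : ConvexOn ℝ (Icc lam rho) E)
    (hc : ContinuousOn E (Icc lam rho)) {H : ℝ → ℝ}
    (hH : ∀ x ∈ Ico lam rho, HasDerivWithinAt E (H x) (Ioi x) x) {x : ℝ} (hx : x ∈ Ico lam rho) :
    Tendsto H (𝓝[>] x) (𝓝 (H x)) := by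
  have hxI : x ∈ Icc lam rho := ⟨hx.1, hx.2.le⟩
  have hev : ∀ᶠ z in 𝓝[>] x, z ∈ Ioo x rho := Ioo_mem_nhdsGT hx.2
  refine tendsto_order.2 ⟨fun a ha => ?_, fun a ha => ?_⟩
  · filter_upwards [hev] with z hz
    have hzI : z ∈ Icc lam rho := ⟨hx.1.trans hz.1.le, hz.2.le⟩
    have hadj : H x ≤ H z := by
      refine ge_of_tendsto ((hasDerivWithinAt_iff_tendsto_slope' self_notMem_Ioi).1
        (hH z ⟨hzI.1, hz.2⟩)) ?_
      filter_upwards [Ioo_mem_nhdsGT hz.2] with y hy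
      have h1 := hE.le_slope_of_hasDerivWithinAt_Ioi hxI hzI hz.1 (hH x hx)
      have h2 := hE.slope_mono_adjacent hxI ⟨hzI.1.trans hy.1.le, hy.2.le⟩ hz.1 hy.1
      rw [← slope_def_field, ← slope_def_field] at h2
      exact h1.trans h2
    exact ha.trans_le hadj
  · -- `H z ≤ slope E z y → slope E x y` as `z ↓ x`, and some such slope is below `a`
    obtain ⟨y, hya, hy⟩ := ((((hasDerivWithinAt_iff_tendsto_slope' self_notMem_Ioi).1
      (hH x hx)).eventually (gt_mem_nhds ha)).and hev).exists
    have hyI : y ∈ Icc lam rho := ⟨hx.1.trans hy.1.le, hy.2.le⟩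
    have hlim : Tendsto (fun z => slope E z y) (𝓝[>] x) (𝓝 (slope E x y)) := by
      simp only [slope_def_field]
      have hcE : Tendsto E (𝓝[>] x) (𝓝 (E x)) :=
        ((hc x hxI).mono_of_mem_nhdsWithin (mem_of_superset (Ioo_mem_nhdsGT hx.2)
          fun z hz => ⟨hx.1.trans hz.1.le, hz.2.le⟩)).tendsto
      refine (tendsto_const_nhds.sub hcE).div
        (tendsto_const_nhds.sub (tendsto_nhdsWithin_of_tendsto_nhds tendsto_id)) ?_
      exact (sub_pos.2 hy.1).ne'
    filter_upwards [hlim.eventually (gt_mem_nhds hya), Ioo_mem_nhdsGT hy.1] with z hz hz'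
    have hzI : z ∈ Icc lam rho := ⟨hx.1.trans hz'.1.le, hz'.2.le.trans hyI.2⟩
    exact (hE.le_slope_of_hasDerivWithinAt_Ioi hzI hyI hz'.2
      (hH z ⟨hzI.1, hz'.2.trans_le hyI.2⟩)).trans_lt hz

/-- Right derivatives of a convex function tend from the left to the left derivative. -/
theorem tendsto_rightDeriv_nhdsLT (hE : ConvexOn ℝ (Icc lam rho) E)
    (hc : ContinuousOn E (Icc lam rho)) {H : ℝ → ℝ}
    (hH : ∀ x ∈ Ico lam rho, HasDerivWithinAt E (H x) (Ioi x) x) {x l : ℝ} (hx : x ∈ Ioc lam rho)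
    (hl : HasDerivWithinAt E l (Iio x) x) :
    Tendsto H (𝓝[<] x) (𝓝 l) := by
  have hxI : x ∈ Icc lam rho := ⟨hx.1.le, hx.2⟩
  have hev : ∀ᶠ z in 𝓝[<] x, z ∈ Ioo lam x := Ioo_mem_nhdsLT hx.1
  refine tendsto_order.2 ⟨fun a ha => ?_, fun a ha => ?_⟩
  · obtain ⟨y, hya, hy⟩ := ((((hasDerivWithinAt_iff_tendsto_slope' self_notMem_Iio).1
      hl).eventually (lt_mem_nhds ha)).and hev).exists
    have hyI : y ∈ Icc lam rho := ⟨hy.1.le, hy.2.le.trans hx.2⟩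
    have hlim : Tendsto (fun z => slope E y z) (𝓝[<] x) (𝓝 (slope E y x)) := by
      simp only [slope_def_field]
      have hcE : Tendsto E (𝓝[<] x) (𝓝 (E x)) :=
        ((hc x hxI).mono_of_mem_nhdsWithin (mem_of_superset (Ioo_mem_nhdsLT hx.1)
          fun z hz => ⟨hz.1.le, hz.2.le.trans hx.2⟩)).tendsto
      refine (hcE.sub tendsto_const_nhds).div
        ((tendsto_nhdsWithin_of_tendsto_nhds tendsto_id).sub tendsto_const_nhds) ?_
      exact (sub_pos.2 hy.2).ne'
    rw [slope_comm] at hya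
    filter_upwards [hlim.eventually (lt_mem_nhds hya), Ioo_mem_nhdsLT hy.2] with z hz hz'
    have hzx : z < rho := hz'.2.trans_le hx.2
    have hzl : lam ≤ z := hyI.1.trans hz'.1.le
    refine hz.trans_le (ge_of_tendsto ((hasDerivWithinAt_iff_tendsto_slope' self_notMem_Ioi).1
      (hH z ⟨hzl, hzx⟩)) ?_)
    filter_upwards [Ioo_mem_nhdsGT hzx] with u hu
    have h2 := hE.slope_mono_adjacent hyI ⟨hzl.trans hu.1.le, hu.2.le⟩ hz'.1 hu.1
    rwa [← slope_def_field, ← slope_def_field] at h2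
  · filter_upwards [hev] with z hz
    have hzI : z ∈ Icc lam rho := ⟨hz.1.le, hz.2.le.trans hx.2⟩
    exact ((hE.le_slope_of_hasDerivWithinAt_Ioi hzI hxI hz.2
      (hH z ⟨hzI.1, hz.2.trans_le hx.2⟩)).trans
        (hE.slope_le_of_hasDerivWithinAt_Iio hzI hxI hz.2 hl)).trans_lt ha

end OneSided

/-! ### The generalized inverse of the slope of the envelope -/

section Inverse

variable {G : ℝ → ℝ} {L : ℝ≥0} {lam rho : ℝ}

theorem continuousOn_lowerEnvelope (hle : lam ≤ rho) (hG : LipschitzOnWith L G (Icc lam rho)) :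
    ContinuousOn (lowerEnvelope G lam rho) (Icc lam rho) := by
  refine (LipschitzOnWith.of_dist_le_mul (K := L) fun x hx y hy => ?_).continuousOn
  wlog hxy : x < y generalizing x y
  · rcases (not_lt.1 hxy).eq_or_lt with rfl | h
    · simp
    · rw [dist_comm, dist_comm x]
      exact this y hy x hx h
  have h := slope_lowerEnvelope_mem hle hG hx hy hxy
  rw [slope_def_field, mem_Icc, le_div_iff₀ (sub_pos.2 hxy), div_le_iff₀ (sub_pos.2 hxy)] at h
  rw [dist_comm, dist_comm x, Real.dist_eq, Real.dist_eq, abs_of_pos (sub_pos.2 hxy), abs_le]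
  exact ⟨by linarith [h.1], h.2⟩

theorem exists_rightDeriv_lowerEnvelope (hle : lam ≤ rho) (hG : LipschitzOnWith L G (Icc lam rho))
    {x : ℝ} (hx : x ∈ Ico lam rho) :
    ∃ l, HasDerivWithinAt (lowerEnvelope G lam rho) l (Ioi x) x :=
  exists_hasDerivWithinAt_Ioi (convexOn_lowerEnvelope hle hG) hx fun _ hy =>
    (slope_lowerEnvelope_mem hle hG ⟨hx.1, hx.2.le⟩ ⟨hx.1.trans hy.1.le, hy.2⟩ hy.1).1

theorem exists_leftDeriv_lowerEnvelope (hle : lam ≤ rho) (hG : LipschitzOnWith L G (Icc lam rho))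
    {x : ℝ} (hx : x ∈ Ioc lam rho) :
    ∃ l, HasDerivWithinAt (lowerEnvelope G lam rho) l (Iio x) x :=
  exists_hasDerivWithinAt_Iio (convexOn_lowerEnvelope hle hG) hx fun _ hy =>
    (slope_lowerEnvelope_mem hle hG ⟨hy.1, hy.2.le.trans hx.2⟩ ⟨hx.1.le, hx.2⟩ hy.2).2

theorem hasDerivWithinAt_vLow (hlt : lam < rho) (hG : LipschitzOnWith L G (Icc lam rho)) :
    HasDerivWithinAt (lowerEnvelope G lam rho) (vLow G lam rho) (Ioi lam) lam := by
  obtain ⟨l, hl⟩ := exists_rightDeriv_lowerEnvelope hlt.le hG (left_mem_Ico.2 hlt)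
  have h : HasDerivWithinAt (lowerEnvelope G lam rho) l (Icc lam rho) lam :=
    (hasDerivWithinAt_Ioi_iff_Ici.1 hl).mono Icc_subset_Ici_self
  have h' := h.derivWithin (uniqueDiffOn_Icc hlt lam (left_mem_Icc.2 hlt.le))
  rwa [vLow, h']

theorem hasDerivWithinAt_vHigh (hlt : lam < rho) (hG : LipschitzOnWith L G (Icc lam rho)) :
    HasDerivWithinAt (lowerEnvelope G lam rho) (vHigh G lam rho) (Iio rho) rho := by
  obtain ⟨l, hl⟩ := exists_leftDeriv_lowerEnvelope hlt.le hG (right_mem_Ioc.2 hlt)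
  have h : HasDerivWithinAt (lowerEnvelope G lam rho) l (Icc lam rho) rho :=
    (hasDerivWithinAt_Iio_iff_Iic.1 hl).mono Icc_subset_Iic_self
  have h' := h.derivWithin (uniqueDiffOn_Icc hlt rho (right_mem_Icc.2 hlt.le))
  rwa [vHigh, h']

/-- If secants issuing from `r` have slopes at most `v` to the left and at least `v` to the right
of `r`, then `r` minimizes the tilted function. -/
theorem isTiltMin_of_slope {E : ℝ → ℝ} {v r : ℝ} (hr : r ∈ Icc lam rho)
    (hl : ∀ s ∈ Ico lam r, slope E s r ≤ v) (hh : ∀ s ∈ Ioc r rho, v ≤ slope E r s) :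
    IsTiltMin E lam rho v r := by
  refine ⟨hr, fun s hs => ?_⟩
  rcases lt_trichotomy s r with h | rfl | h
  · exact (slope_le_iff h).1 (hl s ⟨hs.1, h⟩)
  · exact le_rfl
  · exact (le_slope_iff h).1 (hh s ⟨h, hs.2⟩)

theorem IsTiltMin.slope_le {E : ℝ → ℝ} {v r s : ℝ} (h : IsTiltMin E lam rho v r)
    (hs : s ∈ Icc lam rho) (hsr : s < r) : slope E s r ≤ v :=
  (slope_le_iff hsr).2 (h.2 s hs)

theorem IsTiltMin.le_slope {E : ℝ → ℝ} {v r s : ℝ} (h : IsTiltMin E lam rho v r)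
    (hs : s ∈ Icc lam rho) (hrs : r < s) : v ≤ slope E r s :=
  (le_slope_iff hrs).2 (h.2 s hs)

theorem isTiltMin_envelope_left (hlt : lam < rho) (hG : LipschitzOnWith L G (Icc lam rho)) {v : ℝ}
    (hv : v ≤ vLow G lam rho) : IsTiltMin (lowerEnvelope G lam rho) lam rho v lam :=
  isTiltMin_of_slope (left_mem_Icc.2 hlt.le) (by simp) fun s hs => hv.trans <|
    (convexOn_lowerEnvelope hlt.le hG).le_slope_of_hasDerivWithinAt_Ioi (left_mem_Icc.2 hlt.le)
      ⟨hs.1.le, hs.2⟩ hs.1 (hasDerivWithinAt_vLow hlt hG)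

theorem isTiltMin_envelope_right (hlt : lam < rho) (hG : LipschitzOnWith L G (Icc lam rho)) {v : ℝ}
    (hv : vHigh G lam rho ≤ v) : IsTiltMin (lowerEnvelope G lam rho) lam rho v rho :=
  isTiltMin_of_slope (right_mem_Icc.2 hlt.le) (fun s hs => hv.trans' <|
    (convexOn_lowerEnvelope hlt.le hG).slope_le_of_hasDerivWithinAt_Iio
      ⟨hs.1, hs.2.le⟩ (right_mem_Icc.2 hlt.le) hs.2 (hasDerivWithinAt_vHigh hlt hG)) (by simp)

theorem Ishc.mem {h : ℝ → ℝ} (hlt : lam < rho) (hh : Ishc G lam rho h) (v : ℝ) :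
    h v ∈ Icc lam rho := by
  obtain ⟨H, hH⟩ := hh
  rcases lt_or_ge v (vLow G lam rho) with h1 | h1
  · rw [hH.eq_lam v h1]; exact left_mem_Icc.2 hlt.le
  rcases lt_or_ge (vHigh G lam rho) v with h2 | h2
  · rw [hH.eq_rho v h2]; exact right_mem_Icc.2 hlt.le
  exact hH.mem v ⟨h1, h2⟩

/-- Every admissible `h v` minimizes the tilted envelope: by the one-sided limits of `H`, the left
derivative of the envelope at `h v` is at most `v` and the right derivative at least `v`. -/
theorem Ishc.isTiltMin_envelope {h : ℝ → ℝ} (hlt : lam < rho)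
    (hG : LipschitzOnWith L G (Icc lam rho)) (hh : Ishc G lam rho h) (v : ℝ) :
    IsTiltMin (lowerEnvelope G lam rho) lam rho v (h v) := by
  have hm := hh.mem hlt v
  obtain ⟨H, hH⟩ := hh
  have hE := convexOn_lowerEnvelope hlt.le hG
  rcases lt_or_ge v (vLow G lam rho) with h1 | h1
  · rw [hH.eq_lam v h1]
    exact isTiltMin_envelope_left hlt hG h1.le
  rcases lt_or_ge (vHigh G lam rho) v with h2 | h2
  · rw [hH.eq_rho v h2]
    exact isTiltMin_envelope_right hlt hG h2.le
  refine isTiltMin_of_slope hm (fun s hs => ?_) (fun s hs => ?_)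
  · have hlh : lam < h v := hs.1.trans_lt hs.2
    obtain ⟨l, hl, hd⟩ := hH.isHc.left (h v) ⟨hlh, hm.2⟩
    refine (hE.slope_le_of_hasDerivWithinAt_Iio ⟨hs.1, hs.2.le.trans hm.2⟩ hm hs.2 hd).trans
      (le_of_tendsto hl ?_)
    filter_upwards [Ioo_mem_nhdsLT hlh] with α hα
    exact hH.below v ⟨h1, h2⟩ α ⟨hα.1.le, hα.2.le.trans hm.2⟩ hα.2
  · have hlh : h v < rho := hs.1.trans_le hs.2
    obtain ⟨l, hl, hd⟩ := hH.isHc.right (h v) ⟨hm.1, hlh⟩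
    refine (ge_of_tendsto hl ?_).trans
      (hE.le_slope_of_hasDerivWithinAt_Ioi hm ⟨hm.1.trans hs.1.le, hs.2⟩ hs.1 hd)
    filter_upwards [Ioo_mem_nhdsGT hlh] with α hα
    exact hH.above v ⟨h1, h2⟩ α ⟨hm.1.trans hα.1.le, hα.2.le⟩ hα.1

/-- Two distinct minimizers of the tilted envelope force it to be affine in between, so that the
slope lies in `sigmaLow`. -/
theorem mem_sigmaLow_of_two_minimizers (hlt : lam < rho) (hG : LipschitzOnWith L G (Icc lam rho))
    {v r s : ℝ} (hr : IsTiltMin (lowerEnvelope G lam rho) lam rho v r)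
    (hs : IsTiltMin (lowerEnvelope G lam rho) lam rho v s) (hrs : r < s) :
    v ∈ sigmaLow G lam rho := by
  have hE := convexOn_lowerEnvelope hlt.le hG
  set E := lowerEnvelope G lam rho with hEdef
  have hval : ∀ x ∈ Icc r s, E x - v * x = E r - v * r := by
    intro x hx
    have hxI : x ∈ Icc lam rho := ⟨hr.1.1.trans hx.1, hx.2.trans hs.1.2⟩
    refine le_antisymm ?_ (hr.2 x hxI)
    have hcv : ConvexOn ℝ (Icc lam rho) (fun x => E x + (0 + (-v) * x)) :=
      hE.add (convexOn_affine 0 (-v) lam rho)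
    have h1 := hcv.le_max_of_mem_Icc hr.1 hs.1 hx
    have h2 := hs.2 r hr.1
    have h3 := hr.2 s hs.1
    rcases le_max_iff.1 h1 with h | h <;> linarith
  have hder : ∀ x ∈ Ioo r s, HasDerivAt E v x := by
    intro x hx
    have h0 : HasDerivAt (fun y => (E r - v * r) + v * y) v x := by
      simpa using ((hasDerivAt_id x).const_mul v).const_add (E r - v * r)
    refine h0.congr_of_eventuallyEq ?_
    filter_upwards [Ioo_mem_nhds hx.1 hx.2] with y hy
    linarith [hval y ⟨hy.1.le, hy.2.le⟩]
  refine ⟨⟨?_, ?_⟩, r, s, hrs, fun x hx => ⟨hr.1.1.trans hx.1.le, hx.2.le.trans hs.1.2⟩, hder⟩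
  · have hls : lam < s := hr.1.1.trans_lt hrs
    exact (hE.le_slope_of_hasDerivWithinAt_Ioi (left_mem_Icc.2 hlt.le) hs.1 hls
      (hasDerivWithinAt_vLow hlt hG)).trans (hs.slope_le (left_mem_Icc.2 hlt.le) hls)
  · have hrr : r < rho := hrs.trans_le hs.1.2
    exact (hr.le_slope (right_mem_Icc.2 hlt.le) hrr).trans
      (hE.slope_le_of_hasDerivWithinAt_Iio hr.1 (right_mem_Icc.2 hlt.le) hrr
        (hasDerivWithinAt_vHigh hlt hG))

/-- Off `sigmaLow`, the value `h v` is the unique minimizer of the tilted flux. -/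
theorem Ishc.isTiltMin_iff {h : ℝ → ℝ} (hlt : lam < rho)
    (hG : LipschitzOnWith L G (Icc lam rho)) (hh : Ishc G lam rho h) {v : ℝ}
    (hv : v ∉ sigmaLow G lam rho) {r : ℝ} : IsTiltMin G lam rho v r ↔ r = h v := by
  have key : ∀ r, IsTiltMin G lam rho v r → r = h v := by
    intro r hr
    have h1 := (hr.envelope hlt.le hG).2
    have h2 := hh.isTiltMin_envelope hlt hG v
    by_contra hne
    rcases lt_or_gt_of_ne hne with h | h
    · exact hv (mem_sigmaLow_of_two_minimizers hlt hG h1 h2 h)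
    · exact hv (mem_sigmaLow_of_two_minimizers hlt hG h2 h1 h)
  refine ⟨key r, ?_⟩
  rintro rfl
  obtain ⟨r, hr⟩ := exists_isTiltMin hlt.le hG.continuousOn v
  rwa [← key r hr]

theorem countable_sigmaLow (G : ℝ → ℝ) (lam rho : ℝ) : (sigmaLow G lam rho).Countable := by
  choose! a b hab _ hd using fun v (hv : v ∈ sigmaLow G lam rho) => hv.2
  refine Set.PairwiseDisjoint.countable_of_isOpen (s := fun v => Ioo (a v) (b v)) ?_
    (fun _ _ => isOpen_Ioo) fun v hv => nonempty_Ioo.2 (hab v hv)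
  intro v hv w hw hvw
  refine Set.disjoint_left.2 fun x hx hx' => hvw ?_
  exact (hd v hv x hx).unique (hd w hw x hx')

theorem Ishc.monotone {h : ℝ → ℝ} (hlt : lam < rho) (hh : Ishc G lam rho h) : Monotone h := by
  have hm := hh.mem hlt
  obtain ⟨H, hH⟩ := hh
  intro v w hvw
  rcases lt_or_ge v (vLow G lam rho) with h1 | h1
  · rw [hH.eq_lam v h1]; exact (hm w).1
  rcases lt_or_ge (vHigh G lam rho) w with h2 | h2
  · rw [hH.eq_rho w h2]; exact (hm v).2
  exact hH.mono ⟨h1, hvw.trans h2⟩ ⟨h1.trans hvw, h2⟩ hvw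

theorem exists_Ishc (hlt : lam < rho) (hG : LipschitzOnWith L G (Icc lam rho)) :
    ∃ h, Ishc G lam rho h := by
  have hle := hlt.le
  have hE := convexOn_lowerEnvelope hle hG
  have hc := continuousOn_lowerEnvelope hle hG
  set E := lowerEnvelope G lam rho with hEdef
  choose! D hD using fun x (hx : x ∈ Ico lam rho) => exists_rightDeriv_lowerEnvelope hle hG hx
  choose κ hκ using fun v => exists_isTiltMin hle hc v
  -- right derivatives on `[lam, rho)`, and the left derivative `v^*` at `rho`
  let H : ℝ → ℝ := fun x => if x < rho then D x else vHigh G lam rho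
  have hHD : ∀ x ∈ Ico lam rho, H x = D x := fun x hx => if_pos hx.2
  have hHrho : H rho = vHigh G lam rho := if_neg (lt_irrefl _)
  have hH : ∀ x ∈ Ico lam rho, HasDerivWithinAt E (H x) (Ioi x) x := fun x hx => by
    rw [hHD x hx]; exact hD x hx
  have hleft := fun x (hx : x ∈ Ioc lam rho) l hl =>
    tendsto_rightDeriv_nhdsLT hE hc hH (x := x) (l := l) hx hl
  have hHslope : ∀ x ∈ Icc lam rho, ∀ y ∈ Icc lam rho, x < y → H x ≤ slope E x y :=
    fun x hx y hy hxy => hE.le_slope_of_hasDerivWithinAt_Ioi hx hy hxy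
      (hH x ⟨hx.1, hxy.trans_le hy.2⟩)
  have hslopeH : ∀ x ∈ Icc lam rho, ∀ y ∈ Icc lam rho, x < y → slope E x y ≤ H y := by
    intro x hx y hy hxy
    rcases hy.2.eq_or_lt with rfl | hlt'
    · rw [hHrho]
      exact hE.slope_le_of_hasDerivWithinAt_Iio hx hy hxy (hasDerivWithinAt_vHigh hlt hG)
    · refine ge_of_tendsto ((hasDerivWithinAt_iff_tendsto_slope' self_notMem_Ioi).1
        (hH y ⟨hy.1, hlt'⟩)) ?_
      filter_upwards [Ioo_mem_nhdsGT hlt'] with u hu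
      have h2 := hE.slope_mono_adjacent hx ⟨hy.1.trans hu.1.le, hu.2.le⟩ hxy hu.1
      rwa [← slope_def_field, ← slope_def_field] at h2
  let h : ℝ → ℝ := fun v => if v < vLow G lam rho then lam else
    if vHigh G lam rho < v then rho else κ v
  have hhκ : ∀ v ∈ Icc (vLow G lam rho) (vHigh G lam rho), h v = κ v := fun v hv => by
    simp only [h, if_neg (not_lt.2 hv.1), if_neg (not_lt.2 hv.2)]
  have hvle : vLow G lam rho ≤ vHigh G lam rho :=
    (hE.le_slope_of_hasDerivWithinAt_Ioi (left_mem_Icc.2 hle) (right_mem_Icc.2 hle) hlt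
      (hasDerivWithinAt_vLow hlt hG)).trans (hE.slope_le_of_hasDerivWithinAt_Iio
        (left_mem_Icc.2 hle) (right_mem_Icc.2 hle) hlt (hasDerivWithinAt_vHigh hlt hG))
  refine ⟨h, H, ⟨⟨?_, ?_, ?_⟩, ?_, ?_, ?_, ?_, ?_, ?_⟩⟩
  · intro x hx y hy hxy
    rcases hxy.eq_or_lt with rfl | hxy
    · exact le_rfl
    · exact (hHslope x hx y hy hxy).trans (hslopeH x hx y hy hxy)
  · exact fun α hα => ⟨H α, tendsto_rightDeriv_nhdsGT hE hc hH hα, hH α hα⟩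
  · intro α hα
    obtain ⟨l, hl⟩ := exists_leftDeriv_lowerEnvelope hle hG hα
    exact ⟨l, hleft α hα l hl, hl⟩
  · intro v hv w hw hvw
    rw [hhκ v hv, hhκ w hw]
    rcases hvw.eq_or_lt with rfl | hvw
    · exact le_rfl
    · exact (hκ v).le_of_lt (hκ w) hvw
  · intro v hv
    rw [hhκ v hv]
    exact (hκ v).1
  · intro v hv α hα hlt'
    rw [hhκ v hv] at hlt'
    exact (hHslope α hα _ (hκ v).1 hlt').trans ((hκ v).slope_le hα hlt')
  · intro v hv α hα hlt'
    rw [hhκ v hv] at hlt'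
    exact ((hκ v).le_slope hα hlt').trans (hslopeH _ (hκ v).1 α hα hlt')
  · exact fun v hv => if_pos hv
  · intro v hv
    simp only [h, if_pos hv, if_neg (not_lt.2 (hvle.trans hv.le))]

/-! ### Minimizers in the closed set `R` -/

/-- A minimizer in a gap of `R` slides along the affine piece of `G` to an endpoint of the gap. -/
theorem exists_isTiltMin_mem {K : EReal} {R : Set ℝ} (hG : ContinuousOn G (Icc lam rho))
    (hlam : lam ∈ densities K) (hrho : rho ∈ densities K) (hle : lam ≤ rho)
    (hR : IsAffineOnGaps K G R) (hlR : lam ∈ R) (hrR : rho ∈ R) (v : ℝ) :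
    ∃ r ∈ R, IsTiltMin G lam rho v r := by
  obtain ⟨x, hx⟩ := exists_isTiltMin hle hG v
  by_cases hxR : x ∈ R
  · exact ⟨x, hxR, hx⟩
  have hden : Icc lam rho ⊆ densities K := fun y hy =>
    ⟨hlam.1.trans hy.1, (EReal.coe_le_coe_iff.2 hy.2).trans hrho.2⟩
  obtain ⟨a, ⟨haR, ha⟩, hamax⟩ := ((isCompact_Icc (a := lam) (b := x)).inter_left
    hR.isClosed).exists_isGreatest ⟨lam, hlR, left_mem_Icc.2 hx.1.1⟩
  obtain ⟨b, ⟨hbR, hb⟩, hbmin⟩ := ((isCompact_Icc (a := x) (b := rho)).inter_left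
    hR.isClosed).exists_isLeast ⟨rho, hrR, right_mem_Icc.2 hx.1.2⟩
  have hax : a < x := lt_of_le_of_ne ha.2 fun h => hxR (h ▸ haR)
  have hxb : x < b := lt_of_le_of_ne hb.1 fun h => hxR (h ▸ hbR)
  have hgap : ∀ y ∈ Ioo a b, y ∈ densities K \ R := by
    intro y hy
    refine ⟨hden ⟨ha.1.trans hy.1.le, hy.2.le.trans hb.2⟩, fun hyR => ?_⟩
    rcases le_total y x with h | h
    · exact (hamax ⟨hyR, ha.1.trans hy.1.le, h⟩).not_gt hy.1
    · exact (hbmin ⟨hyR, h, hy.2.le.trans hb.2⟩).not_gt hy.2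
  obtain ⟨m, c, hmc⟩ := hR.affine x (hgap x ⟨hax, hxb⟩)
  have haff : ∀ y ∈ Ioo a b, G y = m * y + c := fun y hy => hmc y <|
    (Set.mem_ordConnectedComponent).2 fun z hz =>
      hgap z ((ordConnected_Ioo (a := a) (b := b)).uIcc_subset ⟨hax, hxb⟩ hy hz)
  have hsub : Ioo a b ⊆ Icc lam rho := fun y hy => ⟨ha.1.trans hy.1.le, hy.2.le.trans hb.2⟩
  -- an affine function with an interior minimum is constant
  have hm : m = v := by
    have h1 := hx.2 ((a + x) / 2) (hsub ⟨by linarith, by linarith⟩)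
    have h2 := hx.2 ((x + b) / 2) (hsub ⟨by linarith, by linarith⟩)
    rw [haff x ⟨hax, hxb⟩, haff _ ⟨by linarith, by linarith⟩] at h1 h2
    nlinarith
  have haI : a ∈ Icc lam rho := ⟨ha.1, ha.2.trans hx.1.2⟩
  have hGa : G a = m * a + c := by
    have hcl : ContinuousWithinAt G (Ioo a b) a := (hG a haI).mono hsub
    have : (𝓝[Ioo a b] a).NeBot := left_nhdsWithin_Ioo_neBot (hax.trans hxb)
    refine tendsto_nhds_unique hcl (Tendsto.congr' (f₁ := fun y => m * y + c) ?_ ?_)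
    · filter_upwards [self_mem_nhdsWithin] with y hy using (haff y hy).symm
    · exact (Continuous.tendsto (by fun_prop) a).mono_left nhdsWithin_le_nhds
  refine ⟨a, haR, haI, fun s hs => ?_⟩
  have h1 := hx.2 s hs
  rw [haff x ⟨hax, hxb⟩] at h1
  rw [hGa]
  subst hm
  linarith

/-! ### The mass carried by the fan -/

theorem curlyG_le_add (hle : lam ≤ rho) (hG : ContinuousOn G (Icc lam rho)) {v w r : ℝ}
    (hr : IsTiltMin G lam rho v r) :
    curlyG G w lam rho ≤ curlyG G v lam rho - (w - v) * r := by
  obtain ⟨s, hs⟩ := exists_isTiltMin hle hG w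
  rw [hs.curlyG_eq, hr.curlyG_eq]
  linarith [hs.2 r hr.1]

theorem continuous_curlyG (hle : lam ≤ rho) (hG : ContinuousOn G (Icc lam rho)) :
    Continuous fun v => curlyG G v lam rho := by
  have hB : ∀ r ∈ Icc lam rho, |r| ≤ max |lam| |rho| := fun r hr => abs_le_max_abs_abs hr.1 hr.2
  have hB0 : 0 ≤ max |lam| |rho| := (abs_nonneg _).trans (le_max_left _ _)
  refine (LipschitzWith.of_le_add_mul (Real.toNNReal (max |lam| |rho|)) fun v w => ?_).continuous
  obtain ⟨r, hr⟩ := exists_isTiltMin hle hG w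
  have h := curlyG_le_add hle hG (w := v) hr
  rw [Real.coe_toNNReal _ hB0, Real.dist_eq]
  have h2 : -((v - w) * r) ≤ max |lam| |rho| * |v - w| := by
    calc -((v - w) * r) ≤ |(v - w) * r| := neg_le_abs _
      _ = |r| * |v - w| := by rw [abs_mul, mul_comm]
      _ ≤ _ := by gcongr; exact hB r hr.1
  linarith

/-- At a continuity point of a selection `κ` of minimizers, the concave function
`v ↦ curlyG G v lam rho` has derivative `-κ v`. -/
theorem hasDerivAt_curlyG (hle : lam ≤ rho) (hG : ContinuousOn G (Icc lam rho)) {κ : ℝ → ℝ} {v : ℝ}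
    (hκ : ∀ v, IsTiltMin G lam rho v (κ v)) (hc : ContinuousAt κ v) :
    HasDerivAt (fun v => curlyG G v lam rho) (-κ v) v := by
  rw [hasDerivAt_iff_tendsto_slope]
  have hlim : Tendsto (fun w => -κ w) (𝓝[≠] v) (𝓝 (-κ v)) := (hc.tendsto.mono_left inf_le_left).neg
  have hmin : Tendsto (fun w => min (-κ w) (-κ v)) (𝓝[≠] v) (𝓝 (-κ v)) := by
    simpa using hlim.min (tendsto_const_nhds (x := -κ v))
  have hmax : Tendsto (fun w => max (-κ w) (-κ v)) (𝓝[≠] v) (𝓝 (-κ v)) := by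
    simpa using hlim.max (tendsto_const_nhds (x := -κ v))
  have hb : ∀ w ∈ ({v}ᶜ : Set ℝ), min (-κ w) (-κ v) ≤ slope (fun v => curlyG G v lam rho) v w ∧
      slope (fun v => curlyG G v lam rho) v w ≤ max (-κ w) (-κ v) := by
    intro w hw
    have h1 := curlyG_le_add hle hG (w := w) (hκ v)
    have h2 := curlyG_le_add hle hG (w := v) (hκ w)
    rw [slope_def_field]
    rcases lt_or_gt_of_ne (show w ≠ v from hw) with h | h
    · constructor
      · exact (min_le_right _ _).trans ((le_div_iff_of_neg (sub_neg.2 h)).2 (by linarith))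
      · exact ((div_le_iff_of_neg (sub_neg.2 h)).2 (by linarith)).trans (le_max_left _ _)
    · constructor
      · exact (min_le_left _ _).trans ((le_div_iff₀ (sub_pos.2 h)).2 (by linarith))
      · exact ((div_le_iff₀ (sub_pos.2 h)).2 (by linarith)).trans (le_max_right _ _)
  refine tendsto_of_tendsto_of_tendsto_of_le_of_le' hmin hmax ?_ ?_
  · filter_upwards [self_mem_nhdsWithin] with w hw using (hb w hw).1
  · filter_upwards [self_mem_nhdsWithin] with w hw using (hb w hw).2

theorem IsTiltMin.monotone_selection {κ : ℝ → ℝ} (hκ : ∀ v, IsTiltMin G lam rho v (κ v)) :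
    Monotone κ := by
  intro v w hvw
  rcases hvw.eq_or_lt with rfl | hvw
  · exact le_rfl
  · exact (hκ v).le_of_lt (hκ w) hvw

/-- The mass formula at time `1`. -/
theorem integral_selection (hle : lam ≤ rho) (hG : ContinuousOn G (Icc lam rho)) {κ : ℝ → ℝ}
    (hκ : ∀ v, IsTiltMin G lam rho v (κ v)) (a b : ℝ) :
    ∫ v in a..b, κ v = curlyG G a lam rho - curlyG G b lam rho := by
  have hm := IsTiltMin.monotone_selection hκ
  have h := integral_eq_of_hasDerivAt_off_countable (fun v => curlyG G v lam rho) (fun v => -κ v)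
    (a := a) (b := b) hm.countable_not_continuousAt (continuous_curlyG hle hG).continuousOn
    (fun x hx => hasDerivAt_curlyG hle hG hκ (not_not.1 hx.2)) hm.intervalIntegrable.neg
  rw [intervalIntegral.integral_neg] at h
  linarith

end Inverse

/-! ### Derivatives of convex functions and the fundamental theorem of calculus -/

section ConvexDeriv

variable {φ : ℝ → ℝ} {a b : ℝ}

/-- Off the countable set of jumps of its right derivative, a convex function is differentiable. -/
theorem hasDerivAt_rightDeriv_of_continuousAt (hφ : ConvexOn ℝ (Icc a b) φ) {x : ℝ}
    (hx : x ∈ Ioo a b) (hc : ContinuousWithinAt (fun y => derivWithin φ (Ioi y) y) (Ioo a b) x) :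
    HasDerivAt φ (derivWithin φ (Ioi x) x) x := by
  have hint : interior (Icc a b) = Ioo a b := interior_Icc
  have hr := hφ.hasDerivWithinAt_rightDeriv_of_mem_interior (hint ▸ hx)
  have hl := hφ.hasDerivWithinAt_leftDeriv_of_mem_interior (hint ▸ hx)
  have hlr : derivWithin φ (Iio x) x = derivWithin φ (Ioi x) x := by
    refine le_antisymm (hφ.leftDeriv_le_rightDeriv_of_mem_interior (hint ▸ hx)) ?_
    have hlim : Tendsto (fun y => derivWithin φ (Ioi y) y) (𝓝[<] x)
        (𝓝 (derivWithin φ (Ioi x) x)) :=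
      (hc.mono_of_mem_nhdsWithin (mem_of_superset (Ioo_mem_nhdsLT hx.1)
        fun y hy => ⟨hy.1, hy.2.trans hx.2⟩)).tendsto
    refine le_of_tendsto hlim ?_
    filter_upwards [Ioo_mem_nhdsLT hx.1] with y hy
    have hyI : y ∈ interior (Icc a b) := hint ▸ ⟨hy.1, hy.2.trans hx.2⟩
    exact (hφ.rightDeriv_le_slope_of_mem_interior hyI (Ioo_subset_Icc_self hx) hy.2).trans
      (hφ.slope_le_leftDeriv_of_mem_interior (interior_subset hyI) (hint ▸ hx) hy.2)
  rw [hlr] at hl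
  have h := (hasDerivWithinAt_Iio_iff_Iic.1 hl).union (hasDerivWithinAt_Ioi_iff_Ici.1 hr)
  rwa [Iic_union_Ici, hasDerivWithinAt_univ] at h

theorem monotoneOn_rightDeriv_Ioo (hφ : ConvexOn ℝ (Icc a b) φ) :
    MonotoneOn (fun y => derivWithin φ (Ioi y) y) (Ioo a b) := by
  have h := hφ.monotoneOn_rightDeriv
  rwa [interior_Icc] at h

theorem ae_deriv_eq_rightDeriv (hφ : ConvexOn ℝ (Icc a b) φ) :
    ∀ᵐ x, x ∈ Ioo a b → HasDerivAt φ (derivWithin φ (Ioi x) x) x := by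
  filter_upwards [(monotoneOn_rightDeriv_Ioo hφ).countable_not_continuousWithinAt.ae_notMem volume]
    with x hx hxI
  exact hasDerivAt_rightDeriv_of_continuousAt hφ hxI (not_not.1 fun h => hx ⟨hxI, h⟩)

theorem ae_deriv_eq_rightDeriv_uIoc (hφ : ConvexOn ℝ (Icc a b) φ) (hab : a ≤ b) :
    ∀ᵐ x, x ∈ uIoc a b → derivWithin φ (Ioi x) x = deriv φ x := by
  filter_upwards [ae_deriv_eq_rightDeriv hφ, (countable_singleton b).ae_notMem volume]
    with x hx hxb hxI
  rw [uIoc_of_le hab] at hxI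
  exact (hx ⟨hxI.1, lt_of_le_of_ne hxI.2 hxb⟩).deriv.symm

/-- The derivative of a continuous convex function is integrable up to the endpoints, where it may
be unbounded. -/
theorem intervalIntegrable_rightDeriv (hφ : ConvexOn ℝ (Icc a b) φ)
    (hc : ContinuousOn φ (Icc a b)) (hab : a ≤ b) :
    IntervalIntegrable (fun y => derivWithin φ (Ioi y) y) volume a b := by
  rcases hab.eq_or_lt with rfl | hab
  · simp
  obtain ⟨c, hc1, hc2⟩ := exists_between hab
  have hcI : c ∈ Ioo a b := ⟨hc1, hc2⟩
  have hd : ∀ x ∈ Ioo a b, HasDerivWithinAt φ (derivWithin φ (Ioi x) x) (Ioi x) x := fun x hx =>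
    hφ.hasDerivWithinAt_rightDeriv_of_mem_interior (interior_Icc (a := a) (b := b) ▸ hx)
  have hmono := monotoneOn_rightDeriv_Ioo hφ
  set f := fun y => derivWithin φ (Ioi y) y with hf
  -- subtracting the slope at an interior point `c` makes the derivative one-signed on each side
  set m := f c with hm
  have hlin : ∀ x, HasDerivWithinAt (fun y => m * y) m (Ioi x) x := fun x => by
    simpa using ((hasDerivAt_id x).const_mul m).hasDerivWithinAt
  have h1 : IntegrableOn (fun x => f x - m) (Ioc c b) := by
    refine intervalIntegral.integrableOn_deriv_right_of_nonneg (g := fun y => φ y - m * y)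
      ((hc.mono (Icc_subset_Icc_left hc1.le)).sub (by fun_prop)) (fun x hx => ?_) fun x hx => ?_
    · exact (hd x ⟨hc1.trans hx.1, hx.2⟩).sub (hlin x)
    · exact sub_nonneg.2 (hmono hcI ⟨hc1.trans hx.1, hx.2⟩ hx.1.le)
  have h2 : IntegrableOn (fun x => m - f x) (Ioc a c) := by
    refine intervalIntegral.integrableOn_deriv_right_of_nonneg (g := fun y => m * y - φ y)
      (ContinuousOn.sub (by fun_prop) (hc.mono (Icc_subset_Icc_right hc2.le)))
      (fun x hx => ?_) fun x hx => ?_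
    · exact (hlin x).sub (hd x ⟨hx.1, hx.2.trans hc2⟩)
    · exact sub_nonneg.2 (hmono ⟨hx.1, hx.2.trans hc2⟩ hcI hx.2.le)
  have h1' : IntervalIntegrable f volume c b := by
    have := ((intervalIntegrable_iff_integrableOn_Ioc_of_le hc2.le).2 h1).add
      (intervalIntegrable_const (c := m))
    simpa using this
  have h2' : IntervalIntegrable f volume a c := by
    have := (intervalIntegrable_const (c := m)).sub
      ((intervalIntegrable_iff_integrableOn_Ioc_of_le hc1.le).2 h2)
    simpa using this
  exact h2'.trans h1'

theorem intervalIntegrable_deriv_of_convexOn (hφ : ConvexOn ℝ (Icc a b) φ)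
    (hc : ContinuousOn φ (Icc a b)) (hab : a ≤ b) : IntervalIntegrable (deriv φ) volume a b :=
  (intervalIntegrable_rightDeriv hφ hc hab).congr_ae
    ((ae_restrict_iff' measurableSet_uIoc).2 (ae_deriv_eq_rightDeriv_uIoc hφ hab))

theorem integral_deriv_of_convexOn (hφ : ConvexOn ℝ (Icc a b) φ)
    (hc : ContinuousOn φ (Icc a b)) (hab : a ≤ b) : ∫ x in a..b, deriv φ x = φ b - φ a := by
  rw [← intervalIntegral.integral_eq_sub_of_hasDeriv_right_of_le hab hc
    (f' := fun y => derivWithin φ (Ioi y) y) (fun x hx =>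
      hφ.hasDerivWithinAt_rightDeriv_of_mem_interior (interior_Icc (a := a) (b := b) ▸ hx))
    (intervalIntegrable_rightDeriv hφ hc hab)]
  refine intervalIntegral.integral_congr_ae ?_
  filter_upwards [ae_deriv_eq_rightDeriv_uIoc hφ hab] with x hx hxI using (hx hxI).symm

end ConvexDeriv

/-! ### A monotone weight against the derivative of a bump -/

/-- `∫ f D' ≤ 0` for `f` nondecreasing and `D ≥ 0` vanishing outside `[a, b]`: formally
`∫ f D' = - ∫ D df`. The integration by parts is done on difference quotients of `D`. -/
theorem integral_monotone_mul_deriv_nonpos {f D : ℝ → ℝ} {C : ℝ≥0} {a b : ℝ} (hf : Monotone f)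
    (hD : LipschitzWith C D) (hD0 : ∀ x, 0 ≤ D x) (hDz : ∀ x, x ∉ Icc a b → D x = 0) :
    ∫ x, f x * deriv D x ≤ 0 := by
  have hloc : LocallyIntegrable f := hf.locallyIntegrable
  let s : ℕ → ℝ := fun n => 1 / (n + 1)
  have hs0 : ∀ n, 0 < s n := fun n => Nat.one_div_pos_of_nat
  have hs1 : ∀ n, s n ≤ 1 := fun n => by
    have : (1 : ℝ) / (n + 1) ≤ 1 / 1 := by
      apply one_div_le_one_div_of_le one_pos; linarith [(Nat.cast_nonneg n : (0 : ℝ) ≤ n)]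
    simpa [s] using this
  have hslim : Tendsto s atTop (𝓝[≠] 0) :=
    tendsto_nhdsWithin_iff.2 ⟨tendsto_one_div_add_atTop_nhds_zero_nat,
      Eventually.of_forall fun n => (hs0 n).ne'⟩
  have hcs : HasCompactSupport D := HasCompactSupport.intro isCompact_Icc hDz
  have hfD : ∀ t : ℝ, Integrable fun x => f x * D (x + t) := fun t =>
    hloc.integrable_smul_right_of_hasCompactSupport
      (hD.continuous.comp (continuous_id.add continuous_const))
      (hcs.comp_homeomorph (Homeomorph.addRight t))
  have hlim : Tendsto (fun n => ∫ x, f x * ((s n)⁻¹ * (D (x + s n) - D x))) atTop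
      (𝓝 (∫ x, f x * deriv D x)) := by
    refine tendsto_integral_of_dominated_convergence
      (indicator (Icc (a - 1) b) fun x => |f x| * C) (fun n => ?_) ?_ (fun n => ?_) ?_
    · have : (fun x => f x * ((s n)⁻¹ * (D (x + s n) - D x))) =
          fun x => (s n)⁻¹ * (f x * D (x + s n) - f x * D (x + 0)) := by
        ext x; rw [add_zero]; ring
      rw [this]
      exact (((hfD _).sub (hfD _)).const_mul _).aestronglyMeasurable
    · exact (integrable_indicator_iff measurableSet_Icc).2
        ((hloc.integrableOn_isCompact isCompact_Icc).abs.mul_const _)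
    · refine Eventually.of_forall fun x => ?_
      by_cases hx : x ∈ Icc (a - 1) b
      · rw [indicator_of_mem hx, norm_mul, norm_mul, Real.norm_eq_abs]
        gcongr
        have h := hD.dist_le_mul (x + s n) x
        rw [Real.dist_eq, Real.dist_eq, add_sub_cancel_left, abs_of_pos (hs0 n)] at h
        rw [norm_inv, Real.norm_eq_abs, Real.norm_eq_abs, abs_of_pos (hs0 n),
          inv_mul_le_iff₀ (hs0 n)]
        linarith
      · rw [indicator_of_notMem hx, hDz x fun h => hx ⟨by linarith [h.1], h.2⟩,
          hDz (x + s n) fun h => hx ⟨by linarith [h.1, hs1 n], by linarith [h.2, hs0 n]⟩]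
        simp
    · filter_upwards [hD.ae_differentiableAt_real] with x hx
      have := (hx.hasDerivAt.tendsto_slope_zero.comp hslim).const_mul (f x)
      simpa [Function.comp_def] using this
  refine le_of_tendsto' hlim fun n => ?_
  have h1 : ∫ x, f x * ((s n)⁻¹ * (D (x + s n) - D x)) =
      (s n)⁻¹ * ((∫ x, f x * D (x + s n)) - ∫ x, f x * D (x + 0)) := by
    rw [← integral_sub (hfD _) (hfD _), ← integral_const_mul]
    congr 1; ext x; rw [add_zero]; ring
  have h2 : ∫ x, f x * D (x + s n) ≤ ∫ x, f (x + s n) * D (x + s n) := by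
    refine integral_mono (hfD _) ?_ fun x =>
      mul_le_mul_of_nonneg_right (hf (by linarith [hs0 n])) (hD0 _)
    have := (hfD 0).comp_add_right (s n)
    simpa using this
  have h3 : ∫ x, f (x + s n) * D (x + s n) = ∫ x, f x * D (x + 0) := by
    rw [integral_add_right_eq_self (fun x => f x * D x) (s n)]
    simp
  rw [h1]
  exact mul_nonpos_of_nonneg_of_nonpos (inv_nonneg.2 (hs0 n).le) (by linarith)

/-- The same for a weight that is monotone only on the open interval, hence possibly unbounded at
its ends, by truncation. -/
theorem intervalIntegral_monotoneOn_mul_deriv_nonpos {f D : ℝ → ℝ} {C : ℝ≥0} {a b : ℝ}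
    (hab : a ≤ b) (hf : MonotoneOn f (Ioo a b)) (hfi : IntervalIntegrable f volume a b)
    (hD : LipschitzWith C D) (hD0 : ∀ x, 0 ≤ D x) (hDz : ∀ x, x ∉ Ioo a b → D x = 0) :
    ∫ x in a..b, f x * deriv D x ≤ 0 := by
  let F : ℕ → ℝ → ℝ := fun n x => max (-(n : ℝ)) (min n (f x))
  have hFb : ∀ n x, |F n x| ≤ |f x| := fun n x => by
    have hn : (0 : ℝ) ≤ n := Nat.cast_nonneg n
    simp only [F]
    rcases le_total 0 (f x) with h | h
    · rw [max_eq_right (by linarith [le_min hn h]), abs_of_nonneg (le_min hn h), abs_of_nonneg h]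
      exact min_le_right _ _
    · rw [min_eq_right (h.trans hn), abs_of_nonpos h, abs_of_nonpos (max_le (by linarith) h)]
      exact neg_le_neg (le_max_right _ _)
  have hlim : Tendsto (fun n => ∫ x in a..b, F n x * deriv D x) atTop
      (𝓝 (∫ x in a..b, f x * deriv D x)) := by
    refine intervalIntegral.tendsto_integral_filter_of_dominated_convergence
      (fun x => |f x| * C) (Eventually.of_forall fun n => ?_) (Eventually.of_forall fun n => ?_)
      (hfi.abs.mul_const _) ?_
    · exact ((aemeasurable_const.max (aemeasurable_const.min
        hfi.def'.aestronglyMeasurable.aemeasurable)).aestronglyMeasurable).mul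
          (measurable_deriv D).aestronglyMeasurable
    · refine Eventually.of_forall fun x _ => ?_
      rw [norm_mul]
      exact mul_le_mul (hFb n x) (norm_deriv_le_of_lipschitz hD) (norm_nonneg _) (abs_nonneg _)
    · refine Eventually.of_forall fun x _ => Tendsto.mul_const _ ?_
      refine tendsto_const_nhds.congr' ?_
      obtain ⟨N, hN⟩ := exists_nat_ge |f x|
      filter_upwards [eventually_ge_atTop N] with n hn
      have h : |f x| ≤ n := hN.trans (Nat.cast_le.2 hn)
      rw [abs_le] at h
      simp only [F, min_eq_right h.2, max_eq_right h.1]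
  refine le_of_tendsto' hlim fun n => ?_
  obtain ⟨g, hg, hgF⟩ := MonotoneOn.exists_monotone_extension (f := F n) (s := Ioo a b)
    (fun x hx y hy hxy => max_le_max le_rfl (min_le_min le_rfl (hf hx hy hxy)))
    ⟨-n, by rintro _ ⟨x, -, rfl⟩; exact le_max_left _ _⟩
    ⟨n, by
      rintro _ ⟨x, -, rfl⟩
      exact max_le (by linarith [(Nat.cast_nonneg n : (0 : ℝ) ≤ n)]) (min_le_left _ _)⟩
  have hder : ∀ x, x ∉ Ioo a b → deriv D x = 0 := fun x hx => by
    refine IsLocalMin.deriv_eq_zero (Eventually.of_forall fun y => ?_)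
    rw [hDz x hx]
    exact hD0 y
  have hnp := integral_monotone_mul_deriv_nonpos hg hD hD0
    (fun x hx => hDz x fun h => hx (Ioo_subset_Icc_self h))
  refine le_trans (le_of_eq ?_) hnp
  have hEq : EqOn (fun x => F n x * deriv D x) (fun x => g x * deriv D x) (Ioo a b) :=
    fun x hx => by simp only [hgF hx]
  rw [intervalIntegral.integral_of_le hab, integral_Ioc_eq_integral_Ioo,
    setIntegral_congr_fun measurableSet_Ioo hEq]
  refine setIntegral_eq_integral_of_forall_compl_eq_zero fun x hx => ?_
  rw [hder x hx, mul_zero]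

/-! ### Entropy jumps between minimizers -/

/-- Entropy jump across a piece of the fan. Let `a ≤ b` minimize `G - ξ₁ id` and `G - ξ₂ id`, with
`ξ₁ ≤ ξ ≤ ξ₂`. Then `G` lies above the piecewise affine
`T r = max (G a + ξ₁ (r - a)) (G b + ξ₂ (r - b))`, with equality at `a` and `b`. The part `G - T`
contributes `∫ φ' (G - T)' ≤ 0` because `φ'` is nondecreasing, and the slopes of `T` differ from `ξ`
by at most `ξ₂ - ξ₁`. -/
theorem integral_deriv_mul_le {G φ : ℝ → ℝ} {L : ℝ≥0} {a b x₁ x₂ ξ : ℝ} (hG : LipschitzWith L G)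
    (hφ : ConvexOn ℝ (Icc a b) φ) (hc : ContinuousOn φ (Icc a b)) (hab : a ≤ b)
    (h1 : x₁ ≤ ξ) (h2 : ξ ≤ x₂) (ha : ∀ r ∈ Icc a b, G a - x₁ * a ≤ G r - x₁ * r)
    (hb : ∀ r ∈ Icc a b, G b - x₂ * b ≤ G r - x₂ * r) :
    ∫ x in a..b, deriv φ x * (deriv G x - ξ) ≤ (x₂ - x₁) * ∫ x in a..b, |deriv φ x| := by
  have h12 : x₁ ≤ x₂ := h1.trans h2
  let T : ℝ → ℝ := fun r => max (G a + x₁ * (r - a)) (G b + x₂ * (r - b))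
  have hlin : ∀ m y z : ℝ, LipschitzWith ‖m‖₊ fun r => z + m * (r - y) := fun m y z =>
    LipschitzWith.of_dist_le_mul fun r s => by
      rw [Real.dist_eq, Real.dist_eq, coe_nnnorm, Real.norm_eq_abs, ← abs_mul]
      apply le_of_eq; congr 1; ring
  have hT : LipschitzWith (max ‖x₁‖₊ ‖x₂‖₊) T := (hlin x₁ a (G a)).max (hlin x₂ b (G b))
  have hTm : Monotone fun r => T r - x₁ * r := by
    intro r s hrs
    have e : ∀ r, T r - x₁ * r = max (G a - x₁ * a) (G b - x₂ * b + (x₂ - x₁) * r) := fun r => by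
      simp only [T, ← max_sub_sub_right]; congr 1 <;> ring
    simp only [e]
    exact max_le_max le_rfl (by nlinarith)
  have hTa : Antitone fun r => T r - x₂ * r := by
    intro r s hrs
    have e : ∀ r, T r - x₂ * r = max (G a - x₁ * a - (x₂ - x₁) * r) (G b - x₂ * b) := fun r => by
      simp only [T, ← max_sub_sub_right]; congr 1 <;> ring
    simp only [e]
    exact max_le_max (by nlinarith) le_rfl
  have hTda : T a = G a := by
    have := hb a (left_mem_Icc.2 hab)
    simp only [T, sub_self, mul_zero, add_zero]
    exact max_eq_left (by linarith)
  have hTdb : T b = G b := by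
    have := ha b (right_mem_Icc.2 hab)
    simp only [T, sub_self, mul_zero, add_zero]
    exact max_eq_right (by linarith)
  have hTG : ∀ r ∈ Icc a b, T r ≤ G r := fun r hr =>
    max_le (by linarith [ha r hr]) (by linarith [hb r hr])
  let c : ℝ → ℝ := fun x => max a (min b x)
  have hcL : LipschitzWith 1 c := (LipschitzWith.id.const_min b).const_max a
  have hcI : ∀ x, c x ∈ Icc a b := fun x => ⟨le_max_left _ _, max_le hab (min_le_left _ _)⟩
  have hcx : ∀ x ∈ Ioo a b, c x = x := fun x hx => by
    simp only [c, min_eq_right hx.2.le, max_eq_right hx.1.le]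
  let D : ℝ → ℝ := fun x => G (c x) - T (c x)
  have hD : LipschitzWith (L * 1 + max ‖x₁‖₊ ‖x₂‖₊ * 1) D := (hG.comp hcL).sub (hT.comp hcL)
  have hD0 : ∀ x, 0 ≤ D x := fun x => sub_nonneg.2 (hTG _ (hcI x))
  have hDz : ∀ x, x ∉ Ioo a b → D x = 0 := by
    intro x hx
    rcases le_or_gt x a with h | h
    · have : c x = a := by simp only [c]; exact max_eq_left ((min_le_right _ _).trans h)
      simp only [D, this, hTda, sub_self]
    · have hbx : b ≤ x := not_lt.1 fun h' => hx ⟨h, h'⟩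
      have : c x = b := by simp only [c, min_eq_left hbx, max_eq_right hab]
      simp only [D, this, hTdb, sub_self]
  have hmono := monotoneOn_rightDeriv_Ioo hφ
  have hfi := intervalIntegrable_rightDeriv hφ hc hab
  have hf := ae_deriv_eq_rightDeriv hφ
  have hφi := intervalIntegrable_deriv_of_convexOn hφ hc hab
  set f := fun y => derivWithin φ (Ioi y) y with hfdef
  have hnp := intervalIntegral_monotoneOn_mul_deriv_nonpos hab hmono hfi hD hD0 hDz
  have hfD : IntervalIntegrable (fun x => f x * deriv D x) volume a b := by
    rw [intervalIntegrable_iff] at hfi ⊢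
    exact hfi.mul_bdd (measurable_deriv D).aestronglyMeasurable
      (Eventually.of_forall fun x => norm_deriv_le_of_lipschitz hD)
  have hφG : IntervalIntegrable (fun x => deriv φ x * (deriv G x - ξ)) volume a b := by
    rw [intervalIntegrable_iff] at hφi ⊢
    refine hφi.mul_bdd (c := L + ‖ξ‖) ((measurable_deriv G).sub_const ξ).aestronglyMeasurable
      (Eventually.of_forall fun x => (norm_sub_le _ _).trans ?_)
    gcongr
    exact norm_deriv_le_of_lipschitz hG
  have hpt : ∀ᵐ x, x ∈ Ioo a b →
      deriv φ x * (deriv G x - ξ) ≤ f x * deriv D x + (x₂ - x₁) * |deriv φ x| := by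
    filter_upwards [hf, hG.ae_differentiableAt_real, hT.ae_differentiableAt_real]
      with x hfx hGx hTx hx
    have hfx' : f x = deriv φ x := (hfx hx).deriv.symm
    have hDx : deriv D x = deriv G x - deriv T x := by
      refine HasDerivAt.deriv ((hGx.hasDerivAt.sub hTx.hasDerivAt).congr_of_eventuallyEq ?_)
      filter_upwards [Ioo_mem_nhds hx.1 hx.2] with y hy
      simp only [D, hcx y hy, Pi.sub_apply]
    have hT1 : x₁ ≤ deriv T x := by
      have h := hTm.deriv_nonneg (x := x)
      have h' : HasDerivAt (fun r => T r - x₁ * r) (deriv T x - x₁) x := by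
        simpa using hTx.hasDerivAt.fun_sub ((hasDerivAt_id x).const_mul x₁)
      rw [h'.deriv] at h
      linarith
    have hT2 : deriv T x ≤ x₂ := by
      have h := hTa.deriv_nonpos (x := x)
      have h' : HasDerivAt (fun r => T r - x₂ * r) (deriv T x - x₂) x := by
        simpa using hTx.hasDerivAt.fun_sub ((hasDerivAt_id x).const_mul x₂)
      rw [h'.deriv] at h
      linarith
    have h3 : deriv φ x * (deriv T x - ξ) ≤ (x₂ - x₁) * |deriv φ x| := by
      calc deriv φ x * (deriv T x - ξ) ≤ |deriv φ x * (deriv T x - ξ)| := le_abs_self _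
        _ = |deriv T x - ξ| * |deriv φ x| := by rw [abs_mul, mul_comm]
        _ ≤ (x₂ - x₁) * |deriv φ x| := by
          gcongr
          exact abs_le.2 ⟨by linarith, by linarith⟩
    rw [hfx', hDx]
    linarith
  have hle : ∫ x in a..b, deriv φ x * (deriv G x - ξ) ≤
      ∫ x in a..b, (f x * deriv D x + (x₂ - x₁) * |deriv φ x|) := by
    refine intervalIntegral.integral_mono_ae_restrict hab hφG
      (hfD.add (hφi.abs.const_mul (x₂ - x₁))) ?_
    rw [EventuallyLE, ← restrict_Ioo_eq_restrict_Icc, ae_restrict_iff' measurableSet_Ioo]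
    exact hpt
  rw [intervalIntegral.integral_add hfD (hφi.abs.const_mul (x₂ - x₁)),
    intervalIntegral.integral_const_mul] at hle
  linarith

/-- The jump inequality for the Kruzhkov pair `|w - k|`, `G (max w k) - G (min w k)`, as a function
of the parameter `k`. -/
theorem kruzhkov_jump_le {G : ℝ → ℝ} {a b x₁ x₂ ξ : ℝ} (hab : a ≤ b) (h1 : x₁ ≤ ξ) (h2 : ξ ≤ x₂)
    (ha : ∀ r ∈ Icc a b, G a - x₁ * a ≤ G r - x₁ * r)
    (hb : ∀ r ∈ Icc a b, G b - x₂ * b ≤ G r - x₂ * r) (w : ℝ) :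
    (G (max w b) - G (min w b) - ξ * |w - b|) - (G (max w a) - G (min w a) - ξ * |w - a|) ≤
      (x₂ - x₁) * (b - a) := by
  have hab' := ha b (right_mem_Icc.2 hab)
  have hba' := hb a (left_mem_Icc.2 hab)
  rcases le_total w a with hwa | hwa
  · rw [max_eq_right hwa, min_eq_left hwa, max_eq_right (hwa.trans hab),
      min_eq_left (hwa.trans hab), abs_of_nonpos (by linarith), abs_of_nonpos (by linarith)]
    nlinarith
  · rcases le_total w b with hwb | hwb
    · rw [max_eq_left hwa, min_eq_right hwa, max_eq_right hwb, min_eq_left hwb,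
        abs_of_nonpos (by linarith), abs_of_nonneg (by linarith)]
      have h3 := ha w ⟨hwa, hwb⟩
      have h4 := hb w ⟨hwa, hwb⟩
      nlinarith
    · rw [max_eq_left hwa, min_eq_right hwa, max_eq_left hwb, min_eq_right hwb,
        abs_of_nonneg (by linarith), abs_of_nonneg (by linarith)]
      nlinarith

/-! ### Entropy fluxes -/

section Flux

variable {K : EReal} {G φ : ℝ → ℝ} {L : ℝ≥0}

theorem Icc_subset_densities {a b : ℝ} (ha : 0 ≤ a) (hb : b ∈ densities K) :
    Icc a b ⊆ densities K := fun _ hy =>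
  ⟨ha.trans hy.1, (EReal.coe_le_coe_iff.2 hy.2).trans hb.2⟩

theorem intervalIntegrable_deriv_mul (hG : LipschitzWith L G)
    (hφ : ConvexOn ℝ (densities K) φ) (hc : ContinuousOn φ (densities K)) {a b : ℝ}
    (ha : 0 ≤ a) (hab : a ≤ b) (hb : b ∈ densities K) :
    IntervalIntegrable (fun v => deriv φ v * deriv G v) volume a b := by
  have hsub := Icc_subset_densities ha hb
  have h := intervalIntegrable_deriv_of_convexOn (hφ.subset hsub (convex_Icc _ _)) (hc.mono hsub)
    hab
  rw [intervalIntegrable_iff] at h ⊢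
  exact h.mul_bdd (measurable_deriv G).aestronglyMeasurable
    (Eventually.of_forall fun x => norm_deriv_le_of_lipschitz hG)

theorem entropyFlux_sub (hG : LipschitzWith L G)
    (hφ : ConvexOn ℝ (densities K) φ) (hc : ContinuousOn φ (densities K)) {a b : ℝ}
    (ha : 0 ≤ a) (hab : a ≤ b) (hb : b ∈ densities K) :
    entropyFlux G φ b - entropyFlux G φ a = ∫ v in a..b, deriv φ v * deriv G v := by
  have h1 := intervalIntegrable_deriv_mul hG hφ hc le_rfl (ha.trans hab) hb
  have h2 := intervalIntegrable_deriv_mul hG hφ hc le_rfl ha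
    (Icc_subset_densities ha hb (left_mem_Icc.2 hab))
  rw [entropyFlux, entropyFlux, intervalIntegral.integral_interval_sub_left h1 h2]

/-- The entropy flux at a density only sees the flux function on the densities. -/
theorem entropyFlux_congr {G' : ℝ → ℝ} (h : EqOn G G' (densities K)) {u : ℝ}
    (hu : u ∈ densities K) : entropyFlux G φ u = entropyFlux G' φ u := by
  refine intervalIntegral.integral_congr_ae ?_
  filter_upwards [(countable_singleton u).ae_notMem volume] with x hx hxI
  rw [uIoc_of_le hu.1] at hxI
  have hxu : x < u := lt_of_le_of_ne hxI.2 hx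
  have : G =ᶠ[𝓝 x] G' := by
    filter_upwards [Ioo_mem_nhds hxI.1 hxu] with y hy
    exact h (Icc_subset_densities le_rfl hu ⟨hy.1.le, hy.2.le⟩)
  rw [this.deriv_eq]

theorem continuousOn_entropyFlux (hG : LipschitzWith L G)
    (hφ : ConvexOn ℝ (densities K) φ) (hc : ContinuousOn φ (densities K)) {b : ℝ}
    (hb : b ∈ densities K) : ContinuousOn (entropyFlux G φ) (Icc 0 b) := by
  have h := intervalIntegrable_deriv_mul hG hφ hc le_rfl hb.1 hb
  have h' := intervalIntegral.continuousOn_primitive_interval' h left_mem_uIcc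
  rwa [uIcc_of_le hb.1] at h'

theorem integral_deriv_lipschitz (hG : LipschitzWith L G) (a b : ℝ) :
    ∫ v in a..b, deriv G v = G b - G a :=
  (hG.lipschitzOnWith.absolutelyContinuousOnInterval).integral_deriv_eq_sub

theorem intervalIntegrable_deriv_lipschitz (hG : LipschitzWith L G) (a b : ℝ) :
    IntervalIntegrable (deriv G) volume a b :=
  (hG.lipschitzOnWith.absolutelyContinuousOnInterval).intervalIntegrable_deriv

/-- The flux of the Kruzhkov entropy `|· - k|`, up to a constant. -/
theorem entropyFlux_abs (hG : LipschitzWith L G) {k u : ℝ} (hk : 0 ≤ k) (hu : 0 ≤ u) :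
    entropyFlux G (fun r => |r - k|) u = G (max u k) - G (min u k) + (G 0 - G k) := by
  have hneg : ∀ x < k, deriv (fun r => |r - k|) x = -1 := fun x hx => by
    have h : HasDerivAt (fun r => -(r - k)) (-1) x := ((hasDerivAt_id x).sub_const k).neg
    refine (h.congr_of_eventuallyEq ?_).deriv
    filter_upwards [Iio_mem_nhds hx] with y hy
    exact abs_of_neg (sub_neg.2 hy)
  have hpos : ∀ x > k, deriv (fun r => |r - k|) x = 1 := fun x hx => by
    have h : HasDerivAt (fun r => r - k) 1 x := (hasDerivAt_id x).sub_const k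
    refine (h.congr_of_eventuallyEq ?_).deriv
    filter_upwards [Ioi_mem_nhds hx] with y hy
    exact abs_of_pos (sub_pos.2 hy)
  have hL : ∀ y, 0 ≤ y → y ≤ k → ∀ᵐ x, x ∈ uIoc 0 y →
      -deriv G x = deriv (fun r => |r - k|) x * deriv G x := fun y hy hyk => by
    filter_upwards [(countable_singleton k).ae_notMem volume] with x hx hxI
    rw [uIoc_of_le hy] at hxI
    rw [hneg x (lt_of_le_of_ne (hxI.2.trans hyk) hx), neg_one_mul]
  have hi : ∀ y, 0 ≤ y → y ≤ k → IntervalIntegrable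
      (fun x => deriv (fun r => |r - k|) x * deriv G x) volume 0 y := fun y hy hyk =>
    (intervalIntegrable_deriv_lipschitz hG 0 y).neg.congr_ae
      ((ae_restrict_iff' measurableSet_uIoc).2 (hL y hy hyk))
  have hv : ∀ y, 0 ≤ y → y ≤ k →
      ∫ x in (0 : ℝ)..y, deriv (fun r => |r - k|) x * deriv G x = G 0 - G y := fun y hy hyk => by
    rw [← intervalIntegral.integral_congr_ae (hL y hy hyk), intervalIntegral.integral_neg,
      integral_deriv_lipschitz hG]
    ring
  rcases le_total u k with huk | huk
  · rw [max_eq_right huk, min_eq_left huk, entropyFlux, hv u hu huk]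
    ring
  · have hR : ∀ᵐ x, x ∈ uIoc k u → deriv G x = deriv (fun r => |r - k|) x * deriv G x := by
      refine Eventually.of_forall fun x hxI => ?_
      rw [uIoc_of_le huk] at hxI
      rw [hpos x hxI.1, one_mul]
    have hiR : IntervalIntegrable (fun x => deriv (fun r => |r - k|) x * deriv G x) volume k u :=
      (intervalIntegrable_deriv_lipschitz hG k u).congr_ae
        ((ae_restrict_iff' measurableSet_uIoc).2 hR)
    rw [max_eq_left huk, min_eq_right huk, entropyFlux,
      ← intervalIntegral.integral_add_adjacent_intervals (hi k hk le_rfl) hiR, hv k hk le_rfl,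
      ← intervalIntegral.integral_congr_ae hR, integral_deriv_lipschitz hG]
    ring

end Flux

/-! ### A smooth partition of unity on the line -/

/-- The nonnegative bump `S (y + 1) - S y` built from the smooth transition `S`; its integer
translates sum to `1`. -/
def partitionBump (y : ℝ) : ℝ := Real.smoothTransition (y + 1) - Real.smoothTransition y

theorem partitionBump_nonneg (y : ℝ) : 0 ≤ partitionBump y :=
  sub_nonneg.2 (Real.smoothTransition.monotone (by linarith))

theorem contDiff_partitionBump : ContDiff ℝ ∞ partitionBump :=
  (Real.smoothTransition.contDiff.comp (contDiff_id.add contDiff_const)).sub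
    Real.smoothTransition.contDiff

theorem deriv_smoothTransition_of_nonpos {y : ℝ} (hy : y ≤ 0) :
    deriv Real.smoothTransition y = 0 :=
  IsLocalMin.deriv_eq_zero <| Eventually.of_forall fun z => by
    rw [Real.smoothTransition.zero_of_nonpos hy]; exact Real.smoothTransition.nonneg z

theorem deriv_smoothTransition_of_one_le {y : ℝ} (hy : 1 ≤ y) :
    deriv Real.smoothTransition y = 0 :=
  IsLocalMax.deriv_eq_zero <| Eventually.of_forall fun z => by
    rw [Real.smoothTransition.one_of_one_le hy]; exact Real.smoothTransition.le_one z

theorem deriv_smoothTransition_nonneg (y : ℝ) : 0 ≤ deriv Real.smoothTransition y :=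
  Real.smoothTransition.monotone.deriv_nonneg

theorem exists_deriv_smoothTransition_le : ∃ C, 0 ≤ C ∧ ∀ y, deriv Real.smoothTransition y ≤ C := by
  have hc : Continuous (deriv Real.smoothTransition) :=
    (Real.smoothTransition.contDiff (n := 1)).continuous_deriv le_rfl
  have hcs : HasCompactSupport (deriv Real.smoothTransition) :=
    HasCompactSupport.intro (isCompact_Icc (a := (0 : ℝ)) (b := 1)) fun y hy => by
      rcases le_or_gt y 0 with h | h
      · exact deriv_smoothTransition_of_nonpos h
      · exact deriv_smoothTransition_of_one_le (not_lt.1 fun h' => hy ⟨h.le, h'.le⟩)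
  obtain ⟨C, hC⟩ := hc.bounded_above_of_compact_support hcs
  exact ⟨C, (norm_nonneg _).trans (hC 0), fun y => (le_abs_self _).trans (hC y)⟩

theorem deriv_partitionBump (y : ℝ) : deriv partitionBump y =
    deriv Real.smoothTransition (y + 1) - deriv Real.smoothTransition y := by
  have hd : ∀ z, HasDerivAt Real.smoothTransition (deriv Real.smoothTransition z) z := fun z =>
    ((Real.smoothTransition.contDiff (n := 1)).differentiable one_ne_zero z).hasDerivAt
  exact (((hd (y + 1)).comp_add_const y 1).sub (hd y)).deriv

theorem partitionBump_eq_zero {y : ℝ} (hy : y ≤ -1 ∨ 1 ≤ y) : partitionBump y = 0 := by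
  rcases hy with h | h
  · rw [partitionBump, Real.smoothTransition.zero_of_nonpos (by linarith),
      Real.smoothTransition.zero_of_nonpos (by linarith), sub_zero]
  · rw [partitionBump, Real.smoothTransition.one_of_one_le (by linarith),
      Real.smoothTransition.one_of_one_le h, sub_self]

theorem deriv_partitionBump_eq_zero {y : ℝ} (hy : y ≤ -1 ∨ 1 ≤ y) : deriv partitionBump y = 0 := by
  rw [deriv_partitionBump]
  rcases hy with h | h
  · rw [deriv_smoothTransition_of_nonpos (by linarith),
      deriv_smoothTransition_of_nonpos (by linarith), sub_zero]
  · rw [deriv_smoothTransition_of_one_le (by linarith), deriv_smoothTransition_of_one_le h,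
      sub_self]

theorem sum_translates_eq {F : ℝ → ℝ} (hF : ∀ y, y ≤ -1 ∨ 1 ≤ y → F y = 0) {s : Finset ℤ} {y : ℝ}
    (h0 : ⌊y⌋ ∈ s) (h1 : ⌊y⌋ + 1 ∈ s) (f : ℤ → ℝ) :
    ∑ i ∈ s, F (y - i) * f i =
      F (Int.fract y) * f ⌊y⌋ + F (Int.fract y - 1) * f (⌊y⌋ + 1) := by
  have hsub : ({⌊y⌋, ⌊y⌋ + 1} : Finset ℤ) ⊆ s := by
    intro i hi
    simp only [Finset.mem_insert, Finset.mem_singleton] at hi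
    rcases hi with rfl | rfl <;> assumption
  rw [← Finset.sum_subset hsub, Finset.sum_pair (by lia)]
  · congr 3
    rw [Int.fract]; push_cast; ring
  · intro i _ hi
    simp only [Finset.mem_insert, Finset.mem_singleton, not_or] at hi
    rw [hF, zero_mul]
    rcases lt_or_gt_of_ne hi.1 with h | h
    · right
      have : (i : ℝ) + 1 ≤ ⌊y⌋ := by exact_mod_cast h
      linarith [Int.floor_le y]
    · left
      have h2 : ⌊y⌋ + 2 ≤ i := by lia
      have : (⌊y⌋ : ℝ) + 2 ≤ i := by exact_mod_cast h2
      linarith [Int.lt_floor_add_one y]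

theorem sum_partitionBump_mul {s : Finset ℤ} {y : ℝ} (h0 : ⌊y⌋ ∈ s) (h1 : ⌊y⌋ + 1 ∈ s)
    (f : ℤ → ℝ) : ∑ i ∈ s, partitionBump (y - i) * f i =
      (1 - Real.smoothTransition (Int.fract y)) * f ⌊y⌋ +
        Real.smoothTransition (Int.fract y) * f (⌊y⌋ + 1) := by
  have hf0 := Int.fract_nonneg y
  have hf1 := (Int.fract_lt_one y).le
  rw [sum_translates_eq (fun _ => partitionBump_eq_zero) h0 h1]
  simp only [partitionBump]
  rw [Real.smoothTransition.one_of_one_le (by linarith), sub_add_cancel,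
    Real.smoothTransition.zero_of_nonpos (x := Int.fract y - 1) (by linarith), sub_zero]

theorem sum_deriv_partitionBump_mul {s : Finset ℤ} {y : ℝ} (h0 : ⌊y⌋ ∈ s) (h1 : ⌊y⌋ + 1 ∈ s)
    (f : ℤ → ℝ) : ∑ i ∈ s, deriv partitionBump (y - i) * f i =
      deriv Real.smoothTransition (Int.fract y) * (f (⌊y⌋ + 1) - f ⌊y⌋) := by
  have hf0 := Int.fract_nonneg y
  have hf1 := (Int.fract_lt_one y).le
  rw [sum_translates_eq (fun _ => deriv_partitionBump_eq_zero) h0 h1, deriv_partitionBump,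
    deriv_partitionBump, deriv_smoothTransition_of_one_le (by linarith), sub_add_cancel,
    deriv_smoothTransition_of_nonpos (y := Int.fract y - 1) (by linarith)]
  ring

/-! ### Test functions on the half plane -/

theorem isOpen_halfPlane : IsOpen halfPlane := isOpen_univ.prod isOpen_Ioi

theorem mem_halfPlane {p : ℝ × ℝ} : p ∈ halfPlane ↔ 0 < p.2 := by simp [halfPlane]

theorem measurableSet_halfPlane : MeasurableSet halfPlane := isOpen_halfPlane.measurableSet

/-- Multiplying a test function by a function that is smooth on the open half plane only. -/
theorem IsTestFunction.contDiff_mul {θ q : ℝ × ℝ → ℝ} (hθ : IsTestFunction θ)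
    (hq : ∀ p ∈ halfPlane, ContDiffAt ℝ ∞ q p) : ContDiff ℝ ∞ fun p => θ p * q p := by
  rw [contDiff_iff_contDiffAt]
  intro p
  by_cases hp : p ∈ tsupport θ
  · exact hθ.smooth.contDiffAt.mul (hq p (hθ.support hp))
  · refine (contDiffAt_const (c := (0 : ℝ))).congr_of_eventuallyEq ?_
    filter_upwards [(isClosed_tsupport θ).isOpen_compl.mem_nhds hp] with z hz
    rw [image_eq_zero_of_notMem_tsupport hz, zero_mul]

theorem IsTestFunction.mul {θ q : ℝ × ℝ → ℝ} (hθ : IsTestFunction θ)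
    (hq : ∀ p ∈ halfPlane, ContDiffAt ℝ ∞ q p) (hq0 : ∀ p, 0 ≤ q p) :
    IsTestFunction fun p => θ p * q p where
  smooth := hθ.contDiff_mul hq
  compact := hθ.compact.mul_right
  support := tsupport_mul_subset_left.trans hθ.support
  nonneg p := mul_nonneg (hθ.nonneg p) (hq0 p)

theorem IsTestFunction.continuous_fderiv {θ : ℝ × ℝ → ℝ} (hθ : IsTestFunction θ) (v : ℝ × ℝ) :
    Continuous fun p => fderiv ℝ θ p v :=
  (hθ.smooth.continuous_fderiv (by simp)).clm_apply continuous_const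

theorem IsTestFunction.integrable_fderiv {θ : ℝ × ℝ → ℝ} (hθ : IsTestFunction θ) (v : ℝ × ℝ) :
    Integrable fun p => fderiv ℝ θ p v :=
  (hθ.continuous_fderiv v).integrable_of_hasCompactSupport (hθ.compact.fderiv_apply ℝ v)

theorem IsTestFunction.integral_fderiv {θ : ℝ × ℝ → ℝ} (hθ : IsTestFunction θ) (v : ℝ × ℝ) :
    ∫ p in halfPlane, fderiv ℝ θ p v = 0 := by
  rw [setIntegral_eq_integral_of_forall_compl_eq_zero fun p hp => ?_]
  · have h := integral_smul_fderiv_eq_neg_fderiv_smul_of_integrable (μ := volume) (𝕜 := ℝ)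
      (f := fun _ : ℝ × ℝ => (1 : ℝ)) (g := θ) (v := v) (by simp)
      (by simpa using hθ.integrable_fderiv v)
      (by simpa using hθ.smooth.continuous.integrable_of_hasCompactSupport hθ.compact)
      (fun _ _ => differentiableAt_const _)
      (fun p _ => hθ.smooth.differentiable (by simp) p)
    simpa using h
  · exact image_eq_zero_of_notMem_tsupport (f := fun p => fderiv ℝ θ p v)
      fun h => hp (hθ.support (tsupport_fderiv_apply_subset ℝ v h))

theorem integrableOn_mul_of_bounded {f g : ℝ × ℝ → ℝ} {C : ℝ} (hf : Measurable f)
    (hC : ∀ p ∈ halfPlane, |f p| ≤ C) (hg : Integrable g) :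
    IntegrableOn (fun p => f p * g p) halfPlane :=
  hg.integrableOn.bdd_mul hf.aestronglyMeasurable
    ((ae_restrict_iff' measurableSet_halfPlane).2 (Eventually.of_forall fun p hp => hC p hp))

theorem hasDerivAt_snd_of_differentiableAt {F : ℝ × ℝ → ℝ} {p : ℝ × ℝ}
    (hF : DifferentiableAt ℝ F p) :
    HasDerivAt (fun s => F (p.1, s)) (fderiv ℝ F p (0, 1)) p.2 :=
  HasFDerivAt.comp_hasDerivAt p.2 (f := fun s => (p.1, s)) hF.hasFDerivAt
    ((hasDerivAt_const _ _).prodMk (hasDerivAt_id _))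

theorem hasDerivAt_fst_of_differentiableAt {F : ℝ × ℝ → ℝ} {p : ℝ × ℝ}
    (hF : DifferentiableAt ℝ F p) :
    HasDerivAt (fun s => F (s, p.2)) (fderiv ℝ F p (1, 0)) p.1 :=
  HasFDerivAt.comp_hasDerivAt p.1 (f := fun s => (s, p.2)) hF.hasFDerivAt
    ((hasDerivAt_id _).prodMk (hasDerivAt_const _ _))

/-- Rays through the origin with slopes in a countable set are negligible. -/
theorem ae_div_notMem {N : Set ℝ} (hN : N.Countable) :
    ∀ᵐ p ∂((volume : Measure (ℝ × ℝ)).restrict halfPlane), p.1 / p.2 ∉ N := by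
  rw [ae_restrict_iff' measurableSet_halfPlane, Measure.volume_eq_prod, Measure.ae_prod_iff_ae_ae]
  · filter_upwards [(countable_singleton (0 : ℝ)).ae_notMem volume] with x hx
    filter_upwards [(hN.image fun v => x / v).ae_notMem volume] with t ht hp hxt
    have ht0 : t ≠ 0 := (mem_halfPlane.1 hp).ne'
    have hx0 : x ≠ 0 := hx
    exact ht ⟨x / t, hxt, by field_simp⟩
  · have h : MeasurableSet {p : ℝ × ℝ | p.1 / p.2 ∈ N} :=
      (measurable_fst.div measurable_snd) hN.measurableSet
    exact measurableSet_halfPlane.imp h.compl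

/-! ### Superposition of entropy pairs along a fan -/

/-- The localization of a test function to directions `x / t` near `i * δ`. -/
def fanTest (θ : ℝ × ℝ → ℝ) (δ : ℝ) (i : ℤ) (p : ℝ × ℝ) : ℝ :=
  θ p * partitionBump (p.1 / p.2 / δ - i)

theorem isTestFunction_fanTest {θ : ℝ × ℝ → ℝ} (hθ : IsTestFunction θ) (δ : ℝ) (i : ℤ) :
    IsTestFunction (fanTest θ δ i) := by
  refine hθ.mul (q := fun p => partitionBump (p.1 / p.2 / δ - i)) (fun p hp => ?_)
    fun p => partitionBump_nonneg _
  have hp2 : p.2 ≠ 0 := (mem_halfPlane.1 hp).ne'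
  exact contDiff_partitionBump.contDiffAt.comp p
    (((contDiffAt_fst.div contDiffAt_snd hp2).div_const δ).sub contDiffAt_const)

theorem fderiv_fanTest_snd {θ : ℝ × ℝ → ℝ} (hθ : IsTestFunction θ) {δ : ℝ} (i : ℤ) {p : ℝ × ℝ}
    (hp : 0 < p.2) : fderiv ℝ (fanTest θ δ i) p (0, 1) =
      fderiv ℝ θ p (0, 1) * partitionBump (p.1 / p.2 / δ - i) -
        θ p / p.2 / δ * (p.1 / p.2) * deriv partitionBump (p.1 / p.2 / δ - i) := by
  have h1 := hasDerivAt_snd_of_differentiableAt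
    ((isTestFunction_fanTest hθ δ i).smooth.differentiable (by simp) p)
  have h2 := hasDerivAt_snd_of_differentiableAt (hθ.smooth.differentiable (by simp) p)
  have h3 : HasDerivAt (fun s => p.1 / s / δ - i) (-p.1 / p.2 ^ 2 / δ) p.2 := by
    have e : (fun s => p.1 / s / δ - i) = fun s => p.1 * s⁻¹ / δ - i := by
      ext s; rw [div_eq_mul_inv p.1]
    rw [e]
    exact ((((hasDerivAt_inv hp.ne').const_mul p.1).div_const δ).sub_const (i : ℝ)).congr_deriv
      (by ring)
  have h4 : HasDerivAt (fun s => partitionBump (p.1 / s / δ - i))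
      (deriv partitionBump (p.1 / p.2 / δ - i) * (-p.1 / p.2 ^ 2 / δ)) p.2 :=
    HasDerivAt.comp p.2 (h₂ := partitionBump)
      ((contDiff_partitionBump.differentiable (by simp) _).hasDerivAt) h3
  rw [h1.unique (h2.mul h4)]
  ring

theorem fderiv_fanTest_fst {θ : ℝ × ℝ → ℝ} (hθ : IsTestFunction θ) {δ : ℝ} (i : ℤ) (p : ℝ × ℝ) :
    fderiv ℝ (fanTest θ δ i) p (1, 0) =
      fderiv ℝ θ p (1, 0) * partitionBump (p.1 / p.2 / δ - i) +
        θ p / p.2 / δ * deriv partitionBump (p.1 / p.2 / δ - i) := by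
  have h1 := hasDerivAt_fst_of_differentiableAt
    ((isTestFunction_fanTest hθ δ i).smooth.differentiable (by simp) p)
  have h2 := hasDerivAt_fst_of_differentiableAt (hθ.smooth.differentiable (by simp) p)
  have h3 : HasDerivAt (fun s => s / p.2 / δ - i) (1 / p.2 / δ) p.1 :=
    (((hasDerivAt_id p.1).div_const p.2).div_const δ).sub_const (i : ℝ)
  have h4 : HasDerivAt (fun s => partitionBump (s / p.2 / δ - i))
      (deriv partitionBump (p.1 / p.2 / δ - i) * (1 / p.2 / δ)) p.1 :=
    HasDerivAt.comp p.1 (h₂ := partitionBump)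
      ((contDiff_partitionBump.differentiable (by simp) _).hasDerivAt) h3
  rw [h1.unique (h2.mul h4)]
  ring

/-- The superposition over the grid of mesh `δ`: in each cell, the two adjacent values of the family
`A` are averaged with the weights of the partition of unity. -/
def gridAverage (A : ℝ → ℝ × ℝ → ℝ) (κ : ℝ → ℝ) (δ : ℝ) (p : ℝ × ℝ) : ℝ :=
  (1 - Real.smoothTransition (Int.fract (p.1 / p.2 / δ))) * A (κ (⌊p.1 / p.2 / δ⌋ * δ)) p +
    Real.smoothTransition (Int.fract (p.1 / p.2 / δ)) * A (κ ((⌊p.1 / p.2 / δ⌋ + 1 : ℤ) * δ)) p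

/-- The increment of `W` over the grid cell containing the direction of `p`. -/
def gridIncrement (W : ℝ → ℝ) (δ : ℝ) (p : ℝ × ℝ) : ℝ :=
  W ((⌊p.1 / p.2 / δ⌋ + 1 : ℤ) * δ) - W (⌊p.1 / p.2 / δ⌋ * δ)

theorem floor_cell {δ : ℝ} (hδ : 0 < δ) (ξ : ℝ) :
    (⌊ξ / δ⌋ : ℝ) * δ ≤ ξ ∧ ξ ≤ ((⌊ξ / δ⌋ + 1 : ℤ) : ℝ) * δ := by
  constructor
  · exact (le_div_iff₀ hδ).1 (Int.floor_le _)
  · push_cast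
    exact (div_le_iff₀ hδ).1 (Int.lt_floor_add_one _).le

section Measurability

variable {A : ℝ → ℝ × ℝ → ℝ} {κ W : ℝ → ℝ}

theorem measurable_direction (δ : ℝ) : Measurable fun p : ℝ × ℝ => p.1 / p.2 / δ :=
  (measurable_fst.div measurable_snd).div_const δ

theorem measurable_gridAverage (hκ : Monotone κ) (hAm : ∀ k, Measurable (A k))
    (hAc : ∀ p, Continuous fun k => A k p) (δ : ℝ) : Measurable (gridAverage A κ δ) := by
  have hu : Measurable (Function.uncurry A) :=
    measurable_uncurry_of_continuous_of_measurable hAc hAm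
  have hd := measurable_direction δ
  have hfl : ∀ m : ℤ, Measurable fun p : ℝ × ℝ =>
      A (κ (((⌊p.1 / p.2 / δ⌋ + m : ℤ) : ℝ) * δ)) p := fun m => by
    have hz : Measurable fun p : ℝ × ℝ => κ (((⌊p.1 / p.2 / δ⌋ + m : ℤ) : ℝ) * δ) :=
      hκ.measurable.comp (((measurable_from_top (f := fun z : ℤ => (((z + m : ℤ) : ℝ)))).comp
        (Int.measurable_floor.comp hd)).mul_const δ)
    exact hu.comp (hz.prodMk measurable_id)
  have hS : Measurable fun p : ℝ × ℝ => Real.smoothTransition (Int.fract (p.1 / p.2 / δ)) :=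
    Real.smoothTransition.continuous.measurable.comp (measurable_fract.comp hd)
  have h0 := hfl 0
  simp only [add_zero] at h0
  exact ((measurable_const.sub hS).mul h0).add (hS.mul (hfl 1))

theorem measurable_gridIncrement (hW : Monotone W) (δ : ℝ) : Measurable (gridIncrement W δ) := by
  have hd := measurable_direction δ
  have hfl : ∀ m : ℤ, Measurable fun p : ℝ × ℝ => W (((⌊p.1 / p.2 / δ⌋ + m : ℤ) : ℝ) * δ) :=
    fun m => hW.measurable.comp (((measurable_from_top (f := fun z : ℤ => (((z + m : ℤ) : ℝ)))).comp
        (Int.measurable_floor.comp hd)).mul_const δ)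
  have h0 := hfl 0
  simp only [add_zero] at h0
  exact (hfl 1).sub h0

theorem abs_convexCombination_sub_le {s x y z : ℝ} (h0 : 0 ≤ s) (h1 : s ≤ 1) :
    |(1 - s) * x + s * y - z| ≤ |x - z| + |y - z| := by
  have e : (1 - s) * x + s * y - z = (1 - s) * (x - z) + s * (y - z) := by ring
  rw [e]
  refine (abs_add_le _ _).trans ?_
  rw [abs_mul, abs_mul, abs_of_nonneg h0, abs_of_nonneg (sub_nonneg.2 h1)]
  nlinarith [abs_nonneg (x - z), abs_nonneg (y - z)]

theorem abs_gridAverage_le {C : ℝ} {p : ℝ × ℝ} (hA : ∀ k, |A k p| ≤ C) (δ : ℝ) :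
    |gridAverage A κ δ p| ≤ C + C := by
  have h := abs_convexCombination_sub_le (x := A (κ (⌊p.1 / p.2 / δ⌋ * δ)) p)
    (y := A (κ ((⌊p.1 / p.2 / δ⌋ + 1 : ℤ) * δ)) p) (z := 0)
    (Real.smoothTransition.nonneg (Int.fract (p.1 / p.2 / δ)))
    (Real.smoothTransition.le_one (Int.fract (p.1 / p.2 / δ)))
  simp only [sub_zero] at h
  exact h.trans (add_le_add (hA _) (hA _))

variable {δ : ℕ → ℝ}

theorem tendsto_cell (hδ : ∀ n, 0 < δ n) (hδ0 : Tendsto δ atTop (𝓝 0)) (ξ : ℝ) :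
    Tendsto (fun n => (⌊ξ / δ n⌋ : ℝ) * δ n) atTop (𝓝 ξ) ∧
      Tendsto (fun n => ((⌊ξ / δ n⌋ + 1 : ℤ) : ℝ) * δ n) atTop (𝓝 ξ) := by
  have hlo : Tendsto (fun n => ξ - δ n) atTop (𝓝 ξ) := by simpa using hδ0.const_sub ξ
  have hhi : Tendsto (fun n => ξ + δ n) atTop (𝓝 ξ) := by simpa using hδ0.const_add ξ
  have hc := fun n => floor_cell (hδ n) ξ
  have e : ∀ n, ((⌊ξ / δ n⌋ + 1 : ℤ) : ℝ) * δ n = (⌊ξ / δ n⌋ : ℝ) * δ n + δ n := fun n => by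
    push_cast; ring
  refine ⟨tendsto_of_tendsto_of_tendsto_of_le_of_le hlo tendsto_const_nhds
    (fun n => ?_) (fun n => (hc n).1), tendsto_of_tendsto_of_tendsto_of_le_of_le
      tendsto_const_nhds hhi (fun n => (hc n).2) (fun n => ?_)⟩
  · have := (hc n).2
    rw [e] at this
    simp only
    linarith
  · have := (hc n).1
    simp only [e]
    linarith

theorem tendsto_gridAverage (hδ : ∀ n, 0 < δ n) (hδ0 : Tendsto δ atTop (𝓝 0)) {p : ℝ × ℝ}
    (hAc : Continuous fun k => A k p) (hκ : ContinuousAt κ (p.1 / p.2)) :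
    Tendsto (fun n => gridAverage A κ (δ n) p) atTop (𝓝 (A (κ (p.1 / p.2)) p)) := by
  obtain ⟨h1, h2⟩ := tendsto_cell hδ hδ0 (p.1 / p.2)
  have h1' := (hAc.tendsto _).comp (hκ.tendsto.comp h1)
  have h2' := (hAc.tendsto _).comp (hκ.tendsto.comp h2)
  rw [tendsto_iff_dist_tendsto_zero] at h1' h2' ⊢
  have h0 := h1'.add h2'
  rw [add_zero] at h0
  refine squeeze_zero (fun _ => dist_nonneg) (fun n => ?_) h0
  exact abs_convexCombination_sub_le (Real.smoothTransition.nonneg _)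
    (Real.smoothTransition.le_one _)

theorem tendsto_gridIncrement (hδ : ∀ n, 0 < δ n) (hδ0 : Tendsto δ atTop (𝓝 0)) {p : ℝ × ℝ}
    (hW : ContinuousAt W (p.1 / p.2)) :
    Tendsto (fun n => gridIncrement W (δ n) p) atTop (𝓝 0) := by
  obtain ⟨h1, h2⟩ := tendsto_cell hδ hδ0 (p.1 / p.2)
  simpa [gridIncrement, Function.comp_def] using (hW.tendsto.comp h2).sub (hW.tendsto.comp h1)

end Measurability

/-- Let `A k`, `B k` be entropy pairs, each satisfying the entropy inequality, and let the jump
inequality hold between the values `κ x₁`, `κ x₂` of the nondecreasing function `κ` with an error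
that is a product of increments. Then the pair selected along the fan by `k = κ (x / t)` satisfies
the entropy inequality.

The inequality for `κ (i * δ)` is tested with `θ` localized to the directions `x / t` near `i * δ`.
In the sum over `i`, the derivatives falling on the partition of unity produce the jumps between
consecutive grid values; the error of a cell is at most a constant times the increment of `W` over
that cell, which tends to `0` at continuity points of `W` as the mesh does. -/
theorem superposition {A B : ℝ → ℝ × ℝ → ℝ} {κ W : ℝ → ℝ} {C : ℝ}
    (hκ : Monotone κ) (hW : Monotone W) (hWb : ∀ v, |W v| ≤ C)
    (hAm : ∀ k, Measurable (A k)) (hBm : ∀ k, Measurable (B k))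
    (hAc : ∀ p, Continuous fun k => A k p) (hBc : ∀ p, Continuous fun k => B k p)
    (hAb : ∀ k, ∀ p ∈ halfPlane, |A k p| ≤ C) (hBb : ∀ k, ∀ p ∈ halfPlane, |B k p| ≤ C)
    (hdiss : ∀ v, ∀ θ, IsTestFunction θ → 0 ≤ ∫ p in halfPlane,
      (A (κ v) p * fderiv ℝ θ p (0, 1) + B (κ v) p * fderiv ℝ θ p (1, 0)))
    (hjump : ∀ p ∈ halfPlane, ∀ x₁ x₂ : ℝ, x₁ ≤ p.1 / p.2 → p.1 / p.2 ≤ x₂ →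
      (B (κ x₂) p - p.1 / p.2 * A (κ x₂) p) - (B (κ x₁) p - p.1 / p.2 * A (κ x₁) p) ≤
        (x₂ - x₁) * (W x₂ - W x₁))
    {θ : ℝ × ℝ → ℝ} (hθ : IsTestFunction θ) :
    0 ≤ ∫ p in halfPlane, (A (κ (p.1 / p.2)) p * fderiv ℝ θ p (0, 1) +
      B (κ (p.1 / p.2)) p * fderiv ℝ θ p (1, 0)) := by
  obtain ⟨M, hM0, hM⟩ := exists_deriv_smoothTransition_le
  -- `θ / t` is integrable since `t` is bounded below on the support of `θ`
  have hθt : Integrable fun p : ℝ × ℝ => θ p * p.2⁻¹ :=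
    (hθ.contDiff_mul (q := fun p => p.2⁻¹) fun p hp => contDiffAt_snd.inv
      (mem_halfPlane.1 hp).ne').continuous.integrable_of_hasCompactSupport hθ.compact.mul_right
  have hθt0 : ∀ p ∈ halfPlane, 0 ≤ θ p * p.2⁻¹ := fun p hp =>
    mul_nonneg (hθ.nonneg p) (inv_nonneg.2 (mem_halfPlane.1 hp).le)
  let U : ℝ → ℝ × ℝ → ℝ := fun δ p => gridAverage A κ δ p * fderiv ℝ θ p (0, 1) +
    gridAverage B κ δ p * fderiv ℝ θ p (1, 0) + gridIncrement W δ p * (M * (θ p * p.2⁻¹))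
  have hWi : ∀ δ p, |gridIncrement W δ p| ≤ C + C := fun δ p =>
    (abs_sub _ _).trans (add_le_add (hWb _) (hWb _))
  have hUi1 : ∀ δ, IntegrableOn (fun p => gridAverage A κ δ p * fderiv ℝ θ p (0, 1)) halfPlane :=
    fun δ => integrableOn_mul_of_bounded (measurable_gridAverage hκ hAm hAc δ)
      (fun p hp => abs_gridAverage_le (fun k => hAb k p hp) δ) (hθ.integrable_fderiv _)
  have hUi2 : ∀ δ, IntegrableOn (fun p => gridAverage B κ δ p * fderiv ℝ θ p (1, 0)) halfPlane :=
    fun δ => integrableOn_mul_of_bounded (measurable_gridAverage hκ hBm hBc δ)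
      (fun p hp => abs_gridAverage_le (fun k => hBb k p hp) δ) (hθ.integrable_fderiv _)
  have hUi3 : ∀ δ, IntegrableOn (fun p => gridIncrement W δ p * (M * (θ p * p.2⁻¹))) halfPlane :=
    fun δ => integrableOn_mul_of_bounded (measurable_gridIncrement hW δ)
      (fun p _ => hWi δ p) (hθt.const_mul M)
  have hUi : ∀ δ, IntegrableOn (U δ) halfPlane := fun δ => ((hUi1 δ).add (hUi2 δ)).add (hUi3 δ)
  have hU : ∀ δ, 0 < δ → 0 ≤ ∫ p in halfPlane, U δ p := by
    intro δ hδ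
    -- the directions met by the support of `θ` lie in finitely many cells
    obtain ⟨R, hR⟩ : ∃ R, ∀ p ∈ tsupport θ, |p.1 / p.2 / δ| ≤ R := by
      have hc : ContinuousOn (fun p : ℝ × ℝ => p.1 / p.2 / δ) (tsupport θ) :=
        (continuousOn_fst.div continuousOn_snd
          fun p hp => (mem_halfPlane.1 (hθ.support hp)).ne').div_const δ
      obtain ⟨R, hR⟩ := hθ.compact.isCompact.exists_bound_of_continuousOn hc
      exact ⟨R, hR⟩
    obtain ⟨N, hN⟩ := exists_nat_ge R
    let s : Finset ℤ := Finset.Icc (-(N + 1)) (N + 1)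
    have hs : ∀ p ∈ tsupport θ, ⌊p.1 / p.2 / δ⌋ ∈ s ∧ ⌊p.1 / p.2 / δ⌋ + 1 ∈ s := by
      intro p hp
      have h := abs_le.1 ((hR p hp).trans hN)
      have h1 : -(N : ℤ) ≤ ⌊p.1 / p.2 / δ⌋ := Int.le_floor.2 (by push_cast; exact h.1)
      have h2 : ⌊p.1 / p.2 / δ⌋ ≤ (N : ℤ) := by
        have := (Int.floor_le (p.1 / p.2 / δ)).trans h.2
        exact_mod_cast this
      simp only [s, Finset.mem_Icc]
      lia
    let k : ℤ → ℝ := fun i => κ (i * δ)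
    let F : ℤ → ℝ × ℝ → ℝ := fun i p => A (k i) p * fderiv ℝ (fanTest θ δ i) p (0, 1) +
      B (k i) p * fderiv ℝ (fanTest θ δ i) p (1, 0)
    have hFi : ∀ i, IntegrableOn (F i) halfPlane := fun i =>
      (integrableOn_mul_of_bounded (hAm _) (hAb _)
        ((isTestFunction_fanTest hθ δ i).integrable_fderiv _)).add
      (integrableOn_mul_of_bounded (hBm _) (hBb _)
        ((isTestFunction_fanTest hθ δ i).integrable_fderiv _))
    have hF0 : 0 ≤ ∫ p in halfPlane, ∑ i ∈ s, F i p := by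
      rw [integral_finsetSum _ fun i _ => hFi i]
      exact Finset.sum_nonneg fun i _ => hdiss _ _ (isTestFunction_fanTest hθ δ i)
    refine hF0.trans (setIntegral_mono_on (integrable_finsetSum _ fun i _ => hFi i) (hUi δ)
      measurableSet_halfPlane fun p hp => ?_)
    have hp2 : 0 < p.2 := mem_halfPlane.1 hp
    set y := p.1 / p.2 / δ with hy
    have hFp : ∀ i, F i p = fderiv ℝ θ p (0, 1) * (partitionBump (y - i) * A (k i) p) +
        fderiv ℝ θ p (1, 0) * (partitionBump (y - i) * B (k i) p) +
        θ p / p.2 / δ * (deriv partitionBump (y - i) *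
          (B (k i) p - p.1 / p.2 * A (k i) p)) := fun i => by
      simp only [F]
      rw [fderiv_fanTest_snd hθ i hp2, fderiv_fanTest_fst hθ i p, ← hy]
      ring
    simp only [hFp, Finset.sum_add_distrib, ← Finset.mul_sum]
    by_cases hps : p ∈ tsupport θ
    · obtain ⟨hs0, hs1⟩ := hs p hps
      rw [sum_partitionBump_mul hs0 hs1 fun i => A (k i) p,
        sum_partitionBump_mul hs0 hs1 fun i => B (k i) p,
        sum_deriv_partitionBump_mul hs0 hs1 fun i => B (k i) p - p.1 / p.2 * A (k i) p]
      obtain ⟨hc1, hc2⟩ := floor_cell hδ (p.1 / p.2)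
      have hj := hjump p hp _ _ hc1 hc2
      have hW0 : 0 ≤ gridIncrement W δ p := sub_nonneg.2 (hW (hc1.trans hc2))
      have e : ((⌊p.1 / p.2 / δ⌋ + 1 : ℤ) : ℝ) * δ - (⌊p.1 / p.2 / δ⌋ : ℝ) * δ = δ := by
        push_cast; ring
      rw [e] at hj
      have hS0 := deriv_smoothTransition_nonneg (Int.fract y)
      have h1 : θ p / p.2 / δ * (deriv Real.smoothTransition (Int.fract y) *
          ((B (k (⌊y⌋ + 1)) p - p.1 / p.2 * A (k (⌊y⌋ + 1)) p) -
            (B (k ⌊y⌋) p - p.1 / p.2 * A (k ⌊y⌋) p))) ≤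
          gridIncrement W δ p * (M * (θ p * p.2⁻¹)) := by
        calc _ ≤ θ p / p.2 / δ * (M * (δ * gridIncrement W δ p)) := by
              have h0 : 0 ≤ θ p / p.2 / δ := div_nonneg (div_nonneg (hθ.nonneg p) hp2.le) hδ.le
              refine mul_le_mul_of_nonneg_left ?_ h0
              exact (mul_le_mul_of_nonneg_left hj hS0).trans
                (mul_le_mul_of_nonneg_right (hM _) (mul_nonneg hδ.le hW0))
          _ = _ := by field_simp
      simp only [U, gridAverage, ← hy]
      simp only [k] at h1 ⊢
      linarith
    · have hz : θ p = 0 := image_eq_zero_of_notMem_tsupport hps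
      have hz' : ∀ v, fderiv ℝ θ p v = 0 := fun v =>
        image_eq_zero_of_notMem_tsupport (f := fun p => fderiv ℝ θ p v)
          fun h => hps (tsupport_fderiv_apply_subset ℝ v h)
      simp [U, hz, hz']
  let δ : ℕ → ℝ := fun n => 1 / (n + 1)
  have hδ : ∀ n, 0 < δ n := fun n => Nat.one_div_pos_of_nat
  have hδ0 : Tendsto δ atTop (𝓝 0) := tendsto_one_div_add_atTop_nhds_zero_nat
  refine ge_of_tendsto' (f := fun n => ∫ p in halfPlane, U (δ n) p) (x := atTop) ?_
    fun n => hU _ (hδ n)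
  refine tendsto_integral_of_dominated_convergence
    (fun p => (C + C) * |fderiv ℝ θ p (0, 1)| + (C + C) * |fderiv ℝ θ p (1, 0)| +
      (C + C) * |M * (θ p * p.2⁻¹)|) (fun n => (hUi (δ n)).aestronglyMeasurable) ?_ (fun n => ?_) ?_
  · exact ((((hθ.integrable_fderiv _).abs.const_mul _).add
      ((hθ.integrable_fderiv _).abs.const_mul _)).add
        ((hθt.const_mul M).abs.const_mul _)).integrableOn
  · refine (ae_restrict_iff' measurableSet_halfPlane).2 (Eventually.of_forall fun p hp => ?_)
    refine (norm_add_le _ _).trans (add_le_add ((norm_add_le _ _).trans (add_le_add ?_ ?_)) ?_)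
    · rw [Real.norm_eq_abs, abs_mul]
      exact mul_le_mul_of_nonneg_right (abs_gridAverage_le (fun k => hAb k p hp) _) (abs_nonneg _)
    · rw [Real.norm_eq_abs, abs_mul]
      exact mul_le_mul_of_nonneg_right (abs_gridAverage_le (fun k => hBb k p hp) _) (abs_nonneg _)
    · rw [Real.norm_eq_abs, abs_mul]
      exact mul_le_mul_of_nonneg_right (hWi _ p) (abs_nonneg _)
  · filter_upwards [ae_div_notMem hκ.countable_not_continuousAt,
      ae_div_notMem hW.countable_not_continuousAt] with p hp1 hp2
    have h := (((tendsto_gridAverage hδ hδ0 (hAc p) (not_not.1 hp1)).mul_const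
      (fderiv ℝ θ p (0, 1))).add ((tendsto_gridAverage hδ hδ0 (hBc p) (not_not.1 hp1)).mul_const
      (fderiv ℝ θ p (1, 0)))).add ((tendsto_gridIncrement hδ hδ0 (not_not.1 hp2)).mul_const
      (M * (θ p * p.2⁻¹)))
    rwa [zero_mul, add_zero] at h

/-! ### Finite speed of propagation -/

theorem expNegInvGlue_le_one (x : ℝ) : expNegInvGlue x ≤ 1 := by
  rcases le_or_gt x 0 with h | h
  · rw [expNegInvGlue.zero_of_nonpos h]; exact zero_le_one
  · rw [expNegInvGlue, if_neg (not_le.2 h)]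
    exact Real.exp_le_one_iff.2 (neg_nonpos.2 (inv_nonneg.2 h.le))

theorem hasDerivAt_expNegInvGlue (x : ℝ) :
    HasDerivAt expNegInvGlue (deriv expNegInvGlue x) x :=
  ((expNegInvGlue.contDiff (n := 1)).differentiable one_ne_zero x).hasDerivAt

theorem continuous_deriv_expNegInvGlue : Continuous (deriv expNegInvGlue) :=
  (expNegInvGlue.contDiff (n := 1)).continuous_deriv le_rfl

theorem deriv_expNegInvGlue_nonneg (x : ℝ) : 0 ≤ deriv expNegInvGlue x :=
  expNegInvGlue.monotone.deriv_nonneg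

theorem deriv_expNegInvGlue_pos {x : ℝ} (hx : 0 < x) : 0 < deriv expNegInvGlue x := by
  have h : HasDerivAt (fun y : ℝ => Real.exp (-y⁻¹)) (Real.exp (-x⁻¹) * -(-(x ^ 2)⁻¹)) x :=
    ((hasDerivAt_inv hx.ne').neg).exp
  have h' : expNegInvGlue =ᶠ[𝓝 x] fun y => Real.exp (-y⁻¹) := by
    filter_upwards [Ioi_mem_nhds hx] with y hy
    rw [expNegInvGlue, if_neg (not_le.2 hy)]
  rw [(h.congr_of_eventuallyEq h').deriv, neg_neg]
  positivity

/-- The cutoff of the backward cone `|x| < c - ℓ t`. -/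
def coneCutoff (c ℓ : ℝ) (p : ℝ × ℝ) : ℝ :=
  expNegInvGlue (c - p.1 - ℓ * p.2) * expNegInvGlue (c + p.1 - ℓ * p.2)

/-- A test function supported in a truncated backward cone: it switches on for times between `δ` and
`2 * δ` and decreases afterwards until time `c`. -/
def coneTest (c ℓ δ : ℝ) (p : ℝ × ℝ) : ℝ :=
  Real.smoothTransition (p.2 / δ - 1) * expNegInvGlue (c - p.2) * coneCutoff c ℓ p

theorem coneCutoff_nonneg (c ℓ : ℝ) (p : ℝ × ℝ) : 0 ≤ coneCutoff c ℓ p :=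
  mul_nonneg (expNegInvGlue.nonneg _) (expNegInvGlue.nonneg _)

theorem coneCutoff_le_one (c ℓ : ℝ) (p : ℝ × ℝ) : coneCutoff c ℓ p ≤ 1 :=
  mul_le_one₀ (expNegInvGlue_le_one _) (expNegInvGlue.nonneg _) (expNegInvGlue_le_one _)

theorem continuous_coneCutoff (c ℓ : ℝ) : Continuous (coneCutoff c ℓ) := by
  have h := (expNegInvGlue.contDiff (n := 0)).continuous
  exact (h.comp (by fun_prop : Continuous fun p : ℝ × ℝ => c - p.1 - ℓ * p.2)).mul
    (h.comp (by fun_prop : Continuous fun p : ℝ × ℝ => c + p.1 - ℓ * p.2))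

theorem coneCutoff_eq_zero {c ℓ : ℝ} (hℓ : 0 ≤ ℓ) {p : ℝ × ℝ} (hp2 : 0 ≤ p.2)
    (hp : p.1 ∉ Icc (-c) c) : coneCutoff c ℓ p = 0 := by
  have h0 := mul_nonneg hℓ hp2
  rcases lt_or_ge p.1 (-c) with h | h
  · rw [coneCutoff, expNegInvGlue.zero_of_nonpos (x := c + p.1 - ℓ * p.2) (by linarith), mul_zero]
  · have h' : c < p.1 := not_le.1 fun h' => hp ⟨h, h'⟩
    rw [coneCutoff, expNegInvGlue.zero_of_nonpos (x := c - p.1 - ℓ * p.2) (by linarith), zero_mul]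

/-- Products of time profiles, vanishing outside `[δ, c]`, with the cone cutoff are supported in a
fixed box. -/
theorem mul_coneCutoff_eq_zero {c ℓ δ : ℝ} (hδ : 0 < δ) (hℓ : 0 ≤ ℓ) {f : ℝ → ℝ}
    (hf : ∀ t, t ∉ Icc δ c → f t = 0) {p : ℝ × ℝ} (hp : p ∉ Icc (-c) c ×ˢ Icc δ c) :
    f p.2 * coneCutoff c ℓ p = 0 := by
  by_cases h2 : p.2 ∈ Icc δ c
  · rw [coneCutoff_eq_zero hℓ (hδ.le.trans h2.1) fun h1 => hp ⟨h1, h2⟩, mul_zero]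
  · rw [hf _ h2, zero_mul]

theorem integrable_mul_coneCutoff {c ℓ δ : ℝ} (hδ : 0 < δ) (hℓ : 0 ≤ ℓ) {f : ℝ → ℝ}
    (hc : Continuous f) (hf : ∀ t, t ∉ Icc δ c → f t = 0) :
    Integrable fun p : ℝ × ℝ => f p.2 * coneCutoff c ℓ p :=
  ((hc.comp continuous_snd).mul (continuous_coneCutoff c ℓ)).integrable_of_hasCompactSupport
    (HasCompactSupport.intro (isCompact_Icc.prod isCompact_Icc)
      fun _ hp => mul_coneCutoff_eq_zero hδ hℓ hf hp)

theorem smoothTransition_time_eq_zero {c δ t : ℝ} (hδ : 0 < δ) (ht : t ∉ Icc δ c) :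
    Real.smoothTransition (t / δ - 1) = 0 ∨ c < t := by
  rcases lt_or_ge t δ with h | h
  · left
    refine Real.smoothTransition.zero_of_nonpos ?_
    linarith [(div_le_one hδ).2 h.le]
  · exact Or.inr (not_le.1 fun h' => ht ⟨h, h'⟩)

theorem isTestFunction_coneTest {c ℓ δ : ℝ} (hδ : 0 < δ) (hℓ : 0 ≤ ℓ) :
    IsTestFunction (coneTest c ℓ δ) := by
  have hz : ∀ p : ℝ × ℝ, p ∉ Icc (-c) c ×ˢ Icc δ c → coneTest c ℓ δ p = 0 := fun p hp =>
    mul_coneCutoff_eq_zero hδ hℓ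
      (f := fun t => Real.smoothTransition (t / δ - 1) * expNegInvGlue (c - t)) (fun t ht => by
        rcases smoothTransition_time_eq_zero hδ ht with h | h
        · rw [h, zero_mul]
        · rw [expNegInvGlue.zero_of_nonpos (by linarith), mul_zero]) hp
  have hE : ContDiff ℝ ∞ expNegInvGlue := expNegInvGlue.contDiff
  refine ⟨?_, HasCompactSupport.intro (isCompact_Icc.prod isCompact_Icc) hz, ?_, fun p => ?_⟩
  · refine ContDiff.mul (ContDiff.mul ?_ ?_) (ContDiff.mul ?_ ?_)
    · exact Real.smoothTransition.contDiff.comp ((contDiff_snd.div_const δ).sub contDiff_const)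
    · exact hE.comp (contDiff_const.sub contDiff_snd)
    · exact hE.comp ((contDiff_const.sub contDiff_fst).sub (contDiff_const.mul contDiff_snd))
    · exact hE.comp ((contDiff_const.add contDiff_fst).sub (contDiff_const.mul contDiff_snd))
  · have hbox : tsupport (coneTest c ℓ δ) ⊆ Icc (-c) c ×ˢ Icc δ c :=
      closure_minimal (fun p hp => not_not.1 fun h => hp (hz p h))
        (isClosed_Icc.prod isClosed_Icc)
    exact hbox.trans fun p hp => mem_halfPlane.2 (hδ.trans_le hp.2.1)
  · exact mul_nonneg (mul_nonneg (Real.smoothTransition.nonneg _) (expNegInvGlue.nonneg _))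
      (coneCutoff_nonneg c ℓ p)

theorem fderiv_coneTest_snd {c ℓ δ : ℝ} (hδ : 0 < δ) (hℓ : 0 ≤ ℓ) (p : ℝ × ℝ) :
    fderiv ℝ (coneTest c ℓ δ) p (0, 1) =
      deriv Real.smoothTransition (p.2 / δ - 1) / δ * expNegInvGlue (c - p.2) * coneCutoff c ℓ p -
      Real.smoothTransition (p.2 / δ - 1) * deriv expNegInvGlue (c - p.2) * coneCutoff c ℓ p -
      ℓ * (Real.smoothTransition (p.2 / δ - 1) * expNegInvGlue (c - p.2)) *
        (deriv expNegInvGlue (c - p.1 - ℓ * p.2) * expNegInvGlue (c + p.1 - ℓ * p.2) +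
          expNegInvGlue (c - p.1 - ℓ * p.2) * deriv expNegInvGlue (c + p.1 - ℓ * p.2)) := by
  have h1 := hasDerivAt_snd_of_differentiableAt
    ((isTestFunction_coneTest (c := c) hδ hℓ).smooth.differentiable (by simp) p)
  have hS : HasDerivAt (fun t => Real.smoothTransition (t / δ - 1))
      (deriv Real.smoothTransition (p.2 / δ - 1) * (1 / δ)) p.2 :=
    HasDerivAt.comp p.2 (h₂ := Real.smoothTransition)
      ((Real.smoothTransition.contDiff (n := 1)).differentiable one_ne_zero _).hasDerivAt
      (((hasDerivAt_id p.2).div_const δ).sub_const 1)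
  have hE : HasDerivAt (fun t => expNegInvGlue (c - t))
      (deriv expNegInvGlue (c - p.2) * (-1)) p.2 :=
    HasDerivAt.comp p.2 (h₂ := expNegInvGlue) (hasDerivAt_expNegInvGlue _)
      ((hasDerivAt_id p.2).const_sub c)
  have hlin : ∀ d, HasDerivAt (fun t => d - ℓ * t) (-(ℓ * 1)) p.2 := fun d =>
    ((hasDerivAt_id p.2).const_mul ℓ).const_sub d
  have hB : ∀ d, HasDerivAt (fun t => expNegInvGlue (d - ℓ * t))
      (deriv expNegInvGlue (d - ℓ * p.2) * (-(ℓ * 1))) p.2 := fun d =>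
    HasDerivAt.comp p.2 (h₂ := expNegInvGlue) (hasDerivAt_expNegInvGlue _) (hlin d)
  rw [h1.unique ((hS.mul hE).mul ((hB (c - p.1)).mul (hB (c + p.1))))]
  simp only [coneCutoff, Pi.mul_apply]
  ring

theorem fderiv_coneTest_fst {c ℓ δ : ℝ} (hδ : 0 < δ) (hℓ : 0 ≤ ℓ) (p : ℝ × ℝ) :
    fderiv ℝ (coneTest c ℓ δ) p (1, 0) =
      (Real.smoothTransition (p.2 / δ - 1) * expNegInvGlue (c - p.2)) *
        (-(deriv expNegInvGlue (c - p.1 - ℓ * p.2) * expNegInvGlue (c + p.1 - ℓ * p.2)) +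
          expNegInvGlue (c - p.1 - ℓ * p.2) * deriv expNegInvGlue (c + p.1 - ℓ * p.2)) := by
  have h1 := hasDerivAt_fst_of_differentiableAt
    ((isTestFunction_coneTest (c := c) hδ hℓ).smooth.differentiable (by simp) p)
  have hB : HasDerivAt (fun x => expNegInvGlue (c - x - ℓ * p.2))
      (deriv expNegInvGlue (c - p.1 - ℓ * p.2) * (-1)) p.1 :=
    HasDerivAt.comp p.1 (h₂ := expNegInvGlue) (hasDerivAt_expNegInvGlue _)
      (((hasDerivAt_id p.1).const_sub c).sub_const (ℓ * p.2))
  have hC : HasDerivAt (fun x => expNegInvGlue (c + x - ℓ * p.2))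
      (deriv expNegInvGlue (c + p.1 - ℓ * p.2) * 1) p.1 :=
    HasDerivAt.comp p.1 (h₂ := expNegInvGlue) (hasDerivAt_expNegInvGlue _)
      (((hasDerivAt_id p.1).const_add c).sub_const (ℓ * p.2))
  rw [h1.unique ((hB.mul hC).const_mul
    (Real.smoothTransition (p.2 / δ - 1) * expNegInvGlue (c - p.2)))]
  ring

/-- Tested against `coneTest`, the terms carrying derivatives of the cone cutoff have a sign, since
the flux `q` is at most `ℓ e` and the cone shrinks at speed `ℓ`. -/
theorem mul_fderiv_coneTest_le {c ℓ δ e q : ℝ} (hδ : 0 < δ) (hℓ : 0 ≤ ℓ) (hq : |q| ≤ ℓ * e)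
    (p : ℝ × ℝ) :
    e * fderiv ℝ (coneTest c ℓ δ) p (0, 1) + q * fderiv ℝ (coneTest c ℓ δ) p (1, 0) ≤
      e * (deriv Real.smoothTransition (p.2 / δ - 1) / δ * expNegInvGlue (c - p.2) *
        coneCutoff c ℓ p) - e * (Real.smoothTransition (p.2 / δ - 1) *
          deriv expNegInvGlue (c - p.2) * coneCutoff c ℓ p) := by
  rw [fderiv_coneTest_snd hδ hℓ, fderiv_coneTest_fst hδ hℓ]
  have ha : 0 ≤ Real.smoothTransition (p.2 / δ - 1) * expNegInvGlue (c - p.2) :=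
    mul_nonneg (Real.smoothTransition.nonneg _) (expNegInvGlue.nonneg _)
  have hb : 0 ≤ deriv expNegInvGlue (c - p.1 - ℓ * p.2) * expNegInvGlue (c + p.1 - ℓ * p.2) :=
    mul_nonneg (deriv_expNegInvGlue_nonneg _) (expNegInvGlue.nonneg _)
  have hd : 0 ≤ expNegInvGlue (c - p.1 - ℓ * p.2) * deriv expNegInvGlue (c + p.1 - ℓ * p.2) :=
    mul_nonneg (expNegInvGlue.nonneg _) (deriv_expNegInvGlue_nonneg _)
  generalize Real.smoothTransition (p.2 / δ - 1) * expNegInvGlue (c - p.2) = a at ha ⊢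
  generalize deriv expNegInvGlue (c - p.1 - ℓ * p.2) * expNegInvGlue (c + p.1 - ℓ * p.2) = b
    at hb ⊢
  generalize expNegInvGlue (c - p.1 - ℓ * p.2) * deriv expNegInvGlue (c + p.1 - ℓ * p.2) = d
    at hd ⊢
  obtain ⟨hq1, hq2⟩ := abs_le.1 hq
  nlinarith [mul_nonneg ha (mul_nonneg hb (by linarith : 0 ≤ ℓ * e + q)),
    mul_nonneg ha (mul_nonneg hd (by linarith : 0 ≤ ℓ * e - q))]

/-- A bounded nonnegative `e` with `∂ₜ e + ∂ₓ q ≤ 0`, `|q| ≤ ℓ e` and vanishing initial trace in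
`L¹_loc` is zero almost everywhere. -/
theorem ae_eq_zero_of_dissipated {e q : ℝ × ℝ → ℝ} {C ℓ : ℝ} (hℓ : 0 ≤ ℓ) (hem : Measurable e)
    (hqm : Measurable q) (he0 : ∀ p, 0 ≤ e p) (heC : ∀ p, e p ≤ C) (hq : ∀ p, |q p| ≤ ℓ * e p)
    (hdiss : ∀ θ, IsTestFunction θ →
      0 ≤ ∫ p in halfPlane, (e p * fderiv ℝ θ p (0, 1) + q p * fderiv ℝ θ p (1, 0)))
    (hinit : ∀ a b : ℝ, Tendsto (fun t => ∫ x in Icc a b, e (x, t)) (𝓝[>] 0) (𝓝 0)) :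
    ∀ᵐ p ∂((volume : Measure (ℝ × ℝ)).restrict halfPlane), e p = 0 := by
  obtain ⟨M, hM0, hM⟩ := exists_deriv_smoothTransition_le
  have heb : ∀ p, |e p| ≤ C := fun p => by rw [abs_of_nonneg (he0 p)]; exact heC p
  have hqb : ∀ p, |q p| ≤ ℓ * C := fun p =>
    (hq p).trans (mul_le_mul_of_nonneg_left (heC p) hℓ)
  have hScont : Continuous (deriv Real.smoothTransition) :=
    (Real.smoothTransition.contDiff (n := 1)).continuous_deriv le_rfl
  have hEcont : Continuous expNegInvGlue := (expNegInvGlue.contDiff (n := 0)).continuous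
  have hE'cont := continuous_deriv_expNegInvGlue
  have hE'z : ∀ {x : ℝ}, x < 0 → deriv expNegInvGlue x = 0 := fun {x} hx => by
    refine IsLocalMin.deriv_eq_zero (Eventually.of_forall fun z => ?_)
    rw [expNegInvGlue.zero_of_nonpos hx.le]
    exact expNegInvGlue.nonneg z
  let P : ℝ → ℝ → ℝ × ℝ → ℝ := fun c δ p => Real.smoothTransition (p.2 / δ - 1) *
    deriv expNegInvGlue (c - p.2) * coneCutoff c ℓ p
  have hP0 : ∀ c δ p, 0 ≤ P c δ p := fun c δ p => mul_nonneg
    (mul_nonneg (Real.smoothTransition.nonneg _) (deriv_expNegInvGlue_nonneg _))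
    (coneCutoff_nonneg c ℓ p)
  have hPi : ∀ c δ, 0 < δ → Integrable (P c δ) := fun c δ hδ =>
    integrable_mul_coneCutoff hδ hℓ
      (f := fun t => Real.smoothTransition (t / δ - 1) * deriv expNegInvGlue (c - t))
      ((Real.smoothTransition.continuous.comp (by fun_prop)).mul (hE'cont.comp (by fun_prop)))
      fun t ht => by
        rcases smoothTransition_time_eq_zero hδ ht with h | h
        · rw [h, zero_mul]
        · rw [hE'z (by linarith), mul_zero]
  have hePi : ∀ c δ, 0 < δ → IntegrableOn (fun p => e p * P c δ p) halfPlane := fun c δ hδ =>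
    integrableOn_mul_of_bounded hem (fun p _ => heb p) (hPi c δ hδ)
  -- the decay in the cone is controlled by the mass at times between `δ` and `2 * δ`
  have key : ∀ c δ ε : ℝ, 0 < δ → (∀ t ∈ Icc δ (2 * δ), ∫ x in Icc (-c) c, e (x, t) ≤ ε) →
      ∫ p in halfPlane, e p * P c δ p ≤ M * ε := by
    intro c δ ε hδ hε
    let Q : ℝ × ℝ → ℝ := fun p => deriv Real.smoothTransition (p.2 / δ - 1) / δ *
      expNegInvGlue (c - p.2) * coneCutoff c ℓ p
    have hQi : Integrable Q := integrable_mul_coneCutoff hδ hℓ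
      (f := fun t => deriv Real.smoothTransition (t / δ - 1) / δ * expNegInvGlue (c - t))
      (((hScont.comp (by fun_prop)).div_const δ).mul (hEcont.comp (by fun_prop))) fun t ht => by
        rcases lt_or_ge t δ with h | h
        · rw [deriv_smoothTransition_of_nonpos (by linarith [(div_le_one hδ).2 h.le]), zero_div,
            zero_mul]
        · have h' : c < t := not_le.1 fun h' => ht ⟨h, h'⟩
          rw [expNegInvGlue.zero_of_nonpos (by linarith), mul_zero]
    have heQi : IntegrableOn (fun p => e p * Q p) halfPlane :=
      integrableOn_mul_of_bounded hem (fun p _ => heb p) hQi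
    have hθ := isTestFunction_coneTest (c := c) hδ hℓ
    have hint : IntegrableOn (fun p => e p * fderiv ℝ (coneTest c ℓ δ) p (0, 1) +
        q p * fderiv ℝ (coneTest c ℓ δ) p (1, 0)) halfPlane :=
      (integrableOn_mul_of_bounded hem (fun p _ => heb p) (hθ.integrable_fderiv _)).add
        (integrableOn_mul_of_bounded hqm (fun p _ => hqb p) (hθ.integrable_fderiv _))
    have h1 := (hdiss _ hθ).trans (setIntegral_mono_on hint (heQi.sub (hePi c δ hδ))
      measurableSet_halfPlane fun p _ => mul_fderiv_coneTest_le hδ hℓ (hq p) p)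
    simp only [Pi.sub_apply] at h1
    rw [integral_sub heQi (hePi c δ hδ)] at h1
    refine (sub_nonneg.1 h1).trans ?_
    have hbox : MeasurableSet (Icc (-c) c ×ˢ Icc δ (2 * δ)) :=
      measurableSet_Icc.prod measurableSet_Icc
    have hebox : IntegrableOn e (Icc (-c) c ×ˢ Icc δ (2 * δ)) :=
      Measure.integrableOn_of_bounded (M := C) (isCompact_Icc.prod isCompact_Icc).measure_ne_top
        hem.aestronglyMeasurable (Eventually.of_forall heb)
    have h2 : ∫ p in halfPlane, e p * Q p ≤
        ∫ p in Icc (-c) c ×ˢ Icc δ (2 * δ), M / δ * e p := by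
      rw [← integral_indicator hbox, ← integral_indicator measurableSet_halfPlane]
      refine integral_mono (heQi.integrable_indicator measurableSet_halfPlane)
        ((integrable_indicator_iff hbox).2 (hebox.const_mul (M / δ))) fun p => ?_
      by_cases hp : p ∈ Icc (-c) c ×ˢ Icc δ (2 * δ)
      · rw [indicator_of_mem hp, indicator_of_mem (mem_halfPlane.2 (hδ.trans_le hp.2.1)), mul_comm]
        refine mul_le_mul_of_nonneg_right ?_ (he0 p)
        have hS : 0 ≤ deriv Real.smoothTransition (p.2 / δ - 1) / δ :=
          div_nonneg (deriv_smoothTransition_nonneg _) hδ.le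
        calc Q p ≤ deriv Real.smoothTransition (p.2 / δ - 1) / δ * 1 * 1 :=
              mul_le_mul (mul_le_mul_of_nonneg_left (expNegInvGlue_le_one _) hS)
                (coneCutoff_le_one c ℓ p) (coneCutoff_nonneg c ℓ p) (by simpa using hS)
          _ ≤ M / δ := by
              rw [mul_one, mul_one]
              exact div_le_div_of_nonneg_right (hM _) hδ.le
      · rw [indicator_of_notMem hp]
        by_cases hp' : p ∈ halfPlane
        · have hQ : Q p = 0 := by
            by_cases hp2 : p.2 ∈ Icc δ (2 * δ)
            · simp only [Q]
              rw [coneCutoff_eq_zero hℓ (hδ.le.trans hp2.1) fun h => hp ⟨h, hp2⟩, mul_zero]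
            · have : deriv Real.smoothTransition (p.2 / δ - 1) = 0 := by
                rcases lt_or_ge p.2 δ with h | h
                · exact deriv_smoothTransition_of_nonpos (by linarith [(div_le_one hδ).2 h.le])
                · have h' : 2 * δ < p.2 := not_le.1 fun h' => hp2 ⟨h, h'⟩
                  exact deriv_smoothTransition_of_one_le (by
                    linarith [(le_div_iff₀ hδ).2 h'.le])
              simp only [Q, this, zero_div, zero_mul]
          rw [indicator_of_mem hp', hQ, mul_zero]
        · rw [indicator_of_notMem hp']
    refine h2.trans ?_
    rw [integral_const_mul, Measure.volume_eq_prod, ← Measure.prod_restrict, integral_prod_symm]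
    · have hin : IntegrableOn (fun t => ∫ x in Icc (-c) c, e (x, t)) (Icc δ (2 * δ)) := by
        rw [IntegrableOn, Measure.volume_eq_prod, ← Measure.prod_restrict] at hebox
        exact hebox.integral_prod_right
      have h3 : ∫ t in Icc δ (2 * δ), ∫ x in Icc (-c) c, e (x, t) ≤
          ∫ _ in Icc δ (2 * δ), ε :=
        setIntegral_mono_on hin (integrableOn_const measure_Icc_lt_top.ne) measurableSet_Icc hε
      have h4 : ∫ _ in Icc δ (2 * δ), ε = δ * ε := by
        rw [setIntegral_const, Measure.real, Real.volume_Icc,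
          ENNReal.toReal_ofReal (by linarith), smul_eq_mul]
        ring
      rw [h4] at h3
      calc _ ≤ M / δ * (δ * ε) := mul_le_mul_of_nonneg_left h3 (div_nonneg hM0 hδ.le)
        _ = M * ε := by field_simp
    · rw [Measure.prod_restrict]
      exact hebox
  -- hence `e` vanishes in the cone, from any positive time on
  have hcone : ∀ c δ : ℝ, 0 < δ → ∀ᵐ p ∂((volume : Measure (ℝ × ℝ)).restrict halfPlane),
      e p * P c δ p = 0 := by
    intro c δ hδ
    have h0 : ∫ p in halfPlane, e p * P c δ p = 0 := by
      refine le_antisymm (le_of_forall_pos_le_add fun η hη => ?_)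
        (integral_nonneg fun p => mul_nonneg (he0 p) (hP0 c δ p))
      have hε : 0 < η / (M + 1) := by positivity
      obtain ⟨d, hd, hd'⟩ := (mem_nhdsGT_iff_exists_Ioo_subset).1
        ((hinit (-c) c).eventually (ge_mem_nhds hε))
      have hd0 : (0 : ℝ) < d := hd
      let δ' := min δ (d / 3)
      have hδ' : 0 < δ' := lt_min hδ (by linarith)
      have hk := key c δ' _ hδ' fun t ht => hd' ⟨hδ'.trans_le ht.1, by
        have : δ' ≤ d / 3 := min_le_right _ _
        linarith [ht.2]⟩
      have hmono : ∫ p in halfPlane, e p * P c δ p ≤ ∫ p in halfPlane, e p * P c δ' p := by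
        refine setIntegral_mono_on (hePi c δ hδ) (hePi c δ' hδ') measurableSet_halfPlane
          fun p hp => mul_le_mul_of_nonneg_left ?_ (he0 p)
        refine mul_le_mul_of_nonneg_right (mul_le_mul_of_nonneg_right
          (Real.smoothTransition.monotone ?_) (deriv_expNegInvGlue_nonneg _))
          (coneCutoff_nonneg c ℓ p)
        exact sub_le_sub_right (div_le_div_of_nonneg_left (mem_halfPlane.1 hp).le hδ'
          (min_le_left _ _)) 1
      have hMη : M * (η / (M + 1)) ≤ η := by
        rw [mul_div_assoc', div_le_iff₀ (by linarith)]
        nlinarith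
      linarith
    exact (setIntegral_eq_zero_iff_of_nonneg_ae
      (Eventually.of_forall fun p => mul_nonneg (he0 p) (hP0 c δ p)) (hePi c δ hδ)).1 h0
  have hall : ∀ᵐ p ∂((volume : Measure (ℝ × ℝ)).restrict halfPlane),
      ∀ n : ℕ, e p * P n (1 / (n + 1)) p = 0 :=
    ae_all_iff.2 fun n => hcone n _ Nat.one_div_pos_of_nat
  filter_upwards [hall, ae_restrict_mem measurableSet_halfPlane] with p hp hpH
  have hp2 : 0 < p.2 := mem_halfPlane.1 hpH
  obtain ⟨n, hn⟩ := exists_nat_gt (max (|p.1| + ℓ * p.2) (max p.2 (1 / p.2)))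
  obtain ⟨hn1, hn2⟩ := max_lt_iff.1 hn
  obtain ⟨hn3, hn4⟩ := max_lt_iff.1 hn2
  refine (mul_eq_zero.1 (hp n)).resolve_right (ne_of_gt ?_)
  refine mul_pos (mul_pos (Real.smoothTransition.pos_of_pos ?_) (deriv_expNegInvGlue_pos ?_))
    (mul_pos (expNegInvGlue.pos_of_pos ?_) (expNegInvGlue.pos_of_pos ?_))
  · rw [div_div_eq_mul_div, div_one]
    have := (div_lt_iff₀ hp2).1 hn4
    linarith
  · linarith
  · linarith [le_abs_self p.1]
  · linarith [neg_abs_le p.1]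

/-! ### The fan of minimizers -/

section Fan

variable {K : EReal} {G φ : ℝ → ℝ} {L : ℝ≥0} {lam rho : ℝ} {κ : ℝ → ℝ}

/-- The projection of the line onto `[lam, rho]`. -/
def clamp (lam rho k : ℝ) : ℝ := max lam (min rho k)

theorem clamp_mem (hle : lam ≤ rho) (k : ℝ) : clamp lam rho k ∈ Icc lam rho :=
  ⟨le_max_left _ _, max_le hle (min_le_left _ _)⟩

theorem clamp_of_mem {k : ℝ} (hk : k ∈ Icc lam rho) : clamp lam rho k = k := by
  rw [clamp, min_eq_right hk.2, max_eq_right hk.1]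

theorem continuous_clamp : Continuous (clamp lam rho) := by
  unfold clamp; fun_prop

theorem IsTiltMin.le_on_Icc {v w r s : ℝ} (hr : IsTiltMin G lam rho v r)
    (hs : IsTiltMin G lam rho w s) :
    (∀ x ∈ Icc r s, G r - v * r ≤ G x - v * x) ∧ ∀ x ∈ Icc r s, G s - w * s ≤ G x - w * x :=
  ⟨fun _ hx => hr.2 _ ⟨hr.1.1.trans hx.1, hx.2.trans hs.1.2⟩,
    fun _ hx => hs.2 _ ⟨hr.1.1.trans hx.1, hx.2.trans hs.1.2⟩⟩

/-- The fan of minimizers dissipates every entropy. -/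
theorem fan_dissipates (hG : LipschitzWith L G) (hlam : 0 ≤ lam) (hle : lam ≤ rho)
    (hrho : rho ∈ densities K) (hκ : ∀ v, IsTiltMin G lam rho v (κ v))
    (hφ : ConvexOn ℝ (densities K) φ) (hc : ContinuousOn φ (densities K)) {θ : ℝ × ℝ → ℝ}
    (hθ : IsTestFunction θ) :
    0 ≤ ∫ p in halfPlane, (φ (κ (p.1 / p.2)) * fderiv ℝ θ p (0, 1) +
      entropyFlux G φ (κ (p.1 / p.2)) * fderiv ℝ θ p (1, 0)) := by
  have hmono := IsTiltMin.monotone_selection hκ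
  have hsub := Icc_subset_densities (K := K) hlam hrho
  have hφI := hφ.subset hsub (convex_Icc _ _)
  have hcI := hc.mono hsub
  have hψI : ContinuousOn (entropyFlux G φ) (Icc lam rho) :=
    (continuousOn_entropyFlux hG hφ hc hrho).mono (Icc_subset_Icc_left hlam)
  have hint := (intervalIntegrable_deriv_of_convexOn hφI hcI hle).abs
  have hint' : ∀ x ∈ Icc lam rho, ∀ y ∈ Icc lam rho,
      IntervalIntegrable (fun r => |deriv φ r|) volume x y := fun x hx y hy =>
    hint.mono_set (uIcc_subset_uIcc (by rwa [uIcc_of_le hle]) (by rwa [uIcc_of_le hle]))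
  have hlamI := left_mem_Icc.2 hle
  -- the total variation of the entropy between `lam` and `κ v`
  let V : ℝ → ℝ := fun r => ∫ x in lam..r, |deriv φ x|
  have hV : ∀ x ∈ Icc lam rho, ∀ y ∈ Icc lam rho, V y - V x = ∫ r in x..y, |deriv φ r| :=
    fun x hx y hy => intervalIntegral.integral_interval_sub_left (hint' _ hlamI _ hy)
      (hint' _ hlamI _ hx)
  have hVm : MonotoneOn V (Icc lam rho) := fun x hx y hy hxy => sub_nonneg.1 <| by
    rw [hV x hx y hy]
    exact intervalIntegral.integral_nonneg hxy fun _ _ => abs_nonneg _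
  obtain ⟨C₁, hC₁⟩ := isCompact_Icc.exists_bound_of_continuousOn hcI
  obtain ⟨C₂, hC₂⟩ := isCompact_Icc.exists_bound_of_continuousOn hψI
  have hV0 : V lam = 0 := intervalIntegral.integral_same
  have hVb : ∀ x ∈ Icc lam rho, |V x| ≤ V rho := fun x hx => by
    rw [abs_of_nonneg (hV0 ▸ hVm hlamI hx hx.1)]
    exact hVm hx (right_mem_Icc.2 hle) hx.2
  have h := superposition (κ := κ) (W := fun v => V (κ v)) (C := max (V rho) (max C₁ C₂))
    (A := fun k _ => φ (clamp lam rho k)) (B := fun k _ => entropyFlux G φ (clamp lam rho k))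
    hmono (fun v w hvw => hVm (hκ v).1 (hκ w).1 (hmono hvw))
    (fun v => (hVb _ (hκ v).1).trans (le_max_left _ _))
    (fun _ => measurable_const) (fun _ => measurable_const)
    (fun _ => hcI.comp_continuous continuous_clamp (clamp_mem hle))
    (fun _ => hψI.comp_continuous continuous_clamp (clamp_mem hle))
    (fun k _ _ => (hC₁ _ (clamp_mem hle k)).trans ((le_max_left _ _).trans (le_max_right _ _)))
    (fun k _ _ => (hC₂ _ (clamp_mem hle k)).trans ((le_max_right _ _).trans (le_max_right _ _)))
    (fun v η hη => ?_) (fun p _ x₁ x₂ h1 h2 => ?_) hθ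
  · simpa only [clamp_of_mem (hκ _).1] using h
  · rw [integral_add ((hη.integrable_fderiv _).const_mul _).integrableOn
      ((hη.integrable_fderiv _).const_mul _).integrableOn, integral_const_mul, integral_const_mul,
      hη.integral_fderiv, hη.integral_fderiv]
    simp
  · simp only [clamp_of_mem (hκ _).1]
    have hκ1 := (hκ x₁).1
    have hκ2 := (hκ x₂).1
    have hab : κ x₁ ≤ κ x₂ := hmono (h1.trans h2)
    have hI : Icc (κ x₁) (κ x₂) ⊆ Icc lam rho := Icc_subset_Icc hκ1.1 hκ2.2
    have hb := hsub hκ2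
    have ha0 := hlam.trans hκ1.1
    obtain ⟨hm1, hm2⟩ := (hκ x₁).le_on_Icc (hκ x₂)
    have hφab := hφI.subset hI (convex_Icc _ _)
    have hj := integral_deriv_mul_le hG hφab (hcI.mono hI) hab h1 h2 hm1 hm2
    have e : ∫ x in κ x₁..κ x₂, deriv φ x * (deriv G x - p.1 / p.2) =
        (entropyFlux G φ (κ x₂) - entropyFlux G φ (κ x₁)) -
          p.1 / p.2 * (φ (κ x₂) - φ (κ x₁)) := by
      rw [entropyFlux_sub hG hφ hc ha0 hab hb, ← integral_deriv_of_convexOn hφab (hcI.mono hI) hab,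
        ← intervalIntegral.integral_const_mul, ← intervalIntegral.integral_sub
          (intervalIntegrable_deriv_mul hG hφ hc ha0 hab hb)
          ((intervalIntegrable_deriv_of_convexOn hφab (hcI.mono hI) hab).const_mul _)]
      congr 1; ext x; ring
    rw [e, ← hV _ hκ1 _ hκ2] at hj
    linarith

theorem abs_flux_diff_le (hG : LipschitzWith L G) (w k : ℝ) :
    |G (max w k) - G (min w k)| ≤ L * |w - k| := by
  have h := hG.dist_le_mul (max w k) (min w k)
  rw [Real.dist_eq, Real.dist_eq, max_sub_min_eq_abs, abs_abs] at h
  rwa [abs_sub_comm w k]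

/-- Kato inequality between the fan and a function dissipating the Kruzhkov entropies with
parameters in `[lam, rho]`. -/
theorem kato_fan (hG : LipschitzWith L G) (hlam : 0 ≤ lam) (hle : lam ≤ rho)
    (hκ : ∀ v, IsTiltMin G lam rho v (κ v)) {w : ℝ × ℝ → ℝ} {M : ℝ} (hwm : Measurable w)
    (hw0 : ∀ p, 0 ≤ w p) (hwM : ∀ p, w p ≤ M)
    (hdiss : ∀ k ∈ Icc lam rho, ∀ θ, IsTestFunction θ → 0 ≤ ∫ p in halfPlane,
      (|w p - k| * fderiv ℝ θ p (0, 1) +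
        (G (max (w p) k) - G (min (w p) k)) * fderiv ℝ θ p (1, 0)))
    {θ : ℝ × ℝ → ℝ} (hθ : IsTestFunction θ) :
    0 ≤ ∫ p in halfPlane, (|w p - κ (p.1 / p.2)| * fderiv ℝ θ p (0, 1) +
      (G (max (w p) (κ (p.1 / p.2))) - G (min (w p) (κ (p.1 / p.2)))) *
        fderiv ℝ θ p (1, 0)) := by
  have hmono := IsTiltMin.monotone_selection hκ
  have hM0 : 0 ≤ M := (hw0 (0, 0)).trans (hwM _)
  have hr0 : 0 ≤ rho := hlam.trans hle
  have hb : ∀ p k, k ∈ Icc lam rho → |w p - k| ≤ M + rho := fun p k hk =>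
    abs_le.2 ⟨by linarith [hw0 p, hk.2], by linarith [hwM p, hk.1]⟩
  have hGc := hG.continuous
  have hL0 : (0 : ℝ) ≤ L := L.coe_nonneg
  have h := superposition (κ := κ) (W := κ) (C := (L + 1) * (M + rho))
    (A := fun k p => |w p - clamp lam rho k|)
    (B := fun k p => G (max (w p) (clamp lam rho k)) - G (min (w p) (clamp lam rho k)))
    hmono hmono
    (fun v => abs_le.2 ⟨by nlinarith [(hκ v).1.1], by nlinarith [(hκ v).1.2]⟩)
    (fun k => (hwm.sub_const _).abs)
    (fun k => (hGc.measurable.comp (hwm.max measurable_const)).sub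
      (hGc.measurable.comp (hwm.min measurable_const)))
    (fun p => (continuous_const.sub continuous_clamp).abs)
    (fun p => (hGc.comp (continuous_const.max continuous_clamp)).sub
      (hGc.comp (continuous_const.min continuous_clamp)))
    (fun k p _ => by rw [abs_abs]; nlinarith [hb p _ (clamp_mem hle k)])
    (fun k p _ => by
      nlinarith [hb p _ (clamp_mem hle k), abs_flux_diff_le hG (w p) (clamp lam rho k)])
    (fun v η hη => ?_) (fun p _ x₁ x₂ h1 h2 => ?_) hθ
  · simpa only [clamp_of_mem (hκ _).1] using h
  · simpa only [clamp_of_mem (hκ _).1] using hdiss _ (hκ v).1 η hη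
  · simp only [clamp_of_mem (hκ _).1]
    obtain ⟨hm1, hm2⟩ := (hκ x₁).le_on_Icc (hκ x₂)
    exact kruzhkov_jump_le (hmono (h1.trans h2)) h1 h2 hm1 hm2 (w p)

/-- The initial trace of a self-similar function that is constant for large directions. -/
theorem hasInitialDatum_fan {f : ℝ → ℝ} {b : ℝ} (hf : Measurable f)
    (hmem : ∀ v, f v ∈ Icc lam rho) (hlo : ∀ v, v < -b → f v = lam)
    (hhi : ∀ v, b < v → f v = rho) :
    HasInitialDatum (fun x t => f (x / t)) (riemannDatum lam rho) := by
  intro a c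
  have hR : ∀ x, riemannDatum lam rho x ∈ Icc lam rho := fun x => by
    have hle := (hmem 0).1.trans (hmem 0).2
    unfold riemannDatum
    split_ifs
    exacts [left_mem_Icc.2 hle, right_mem_Icc.2 hle]
  have hRm : Measurable (riemannDatum lam rho) :=
    Measurable.ite measurableSet_Iio measurable_const measurable_const
  have h := tendsto_integral_filter_of_dominated_convergence (μ := volume.restrict (Icc a c))
    (l := 𝓝[>] (0 : ℝ)) (F := fun t x => |f (x / t) - riemannDatum lam rho x|) (f := fun _ => 0)
    (fun _ => rho - lam) ?_ ?_ ?_ ?_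
  · simpa using h
  · exact Eventually.of_forall fun t =>
      (((hf.comp (measurable_id.div_const t)).sub hRm).abs).aestronglyMeasurable
  · refine Eventually.of_forall fun t => Eventually.of_forall fun x => ?_
    rw [Real.norm_eq_abs, abs_abs]
    exact abs_le.2 ⟨by linarith [(hmem (x / t)).1, (hR x).2],
      by linarith [(hmem (x / t)).2, (hR x).1]⟩
  · exact integrable_const _
  · filter_upwards [ae_restrict_of_ae ((countable_singleton (0 : ℝ)).ae_notMem volume)] with x hx
    refine tendsto_const_nhds.congr' ?_
    -- `|x| / t` exceeds `b` for small `t`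
    have hx0 : 0 < |x| := abs_pos.2 hx
    have hev : ∀ᶠ t in 𝓝[>] (0 : ℝ), b * t < |x| :=
      ((continuous_const.mul continuous_id).tendsto' (0 : ℝ) 0 (mul_zero b)).mono_left
        nhdsWithin_le_nhds |>.eventually (gt_mem_nhds hx0)
    filter_upwards [hev, self_mem_nhdsWithin] with t ht ht0
    have ht0 : (0 : ℝ) < t := ht0
    rcases lt_or_gt_of_ne (show x ≠ 0 from hx) with hneg | hpos
    · rw [abs_of_neg hneg] at ht
      rw [hlo _ ((div_lt_iff₀ ht0).2 (by linarith)), riemannDatum, if_pos hneg, sub_self, abs_zero]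
    · rw [abs_of_pos hpos] at ht
      rw [hhi _ ((lt_div_iff₀ ht0).2 ht), riemannDatum, if_neg (not_lt.2 hpos.le), sub_self,
        abs_zero]

end Fan

/-! ### The entropy solution of the Riemann problem -/

section Riemann

variable {K : EReal} {G : ℝ → ℝ} {L : ℝ≥0} {lam rho : ℝ} {h : ℝ → ℝ}

theorem Ishc.hasInitialDatum (hG : LipschitzOnWith L G (Icc lam rho)) (hlt : lam < rho)
    (hh : Ishc G lam rho h) :
    HasInitialDatum (fun x t => h (x / t)) (riemannDatum lam rho) := by
  have hm := hh.mem hlt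
  have hE := hh.isTiltMin_envelope hlt hG
  refine hasInitialDatum_fan (b := L) (hh.monotone hlt).measurable hm (fun v hv => ?_)
    fun v hv => ?_
  · exact le_antisymm ((hE v).le_of_lt ((isTiltMin_left hlt.le hG le_rfl).envelope hlt.le hG).2 hv)
      (hm v).1
  · exact le_antisymm (hm v).2
      (((isTiltMin_right hlt.le hG le_rfl).envelope hlt.le hG).2.le_of_lt (hE v) hv)

theorem Ishc.isEntropySolution (hG : LipschitzOnWith L G (densities K))
    (hlam : lam ∈ densities K) (hrho : rho ∈ densities K) (hlt : lam < rho)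
    (hh : Ishc G lam rho h) : IsEntropySolution K G fun x t => h (x / t) := by
  have hsub := Icc_subset_densities (K := K) hlam.1 hrho
  have hGI := hG.mono hsub
  have hm := hh.mem hlt
  obtain ⟨g, hg, hGg⟩ := hG.extend_real
  choose κ hκ using fun v => exists_isTiltMin hlt.le hGI.continuousOn v
  have hκg : ∀ v, IsTiltMin g lam rho v (κ v) := fun v => ⟨(hκ v).1, fun s hs => by
    rw [← hGg (hsub (hκ v).1), ← hGg (hsub hs)]; exact (hκ v).2 s hs⟩
  refine ⟨(hh.monotone hlt).measurable.comp
    (measurable_fst.div (measurable_subtype_coe.comp measurable_snd)), fun x t _ => hsub (hm _),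
    ⟨rho, fun x t _ => (hm _).2⟩, fun φ hφ hc θ hθ => ?_⟩
  refine (fan_dissipates hg hlam.1 hlt.le hrho hκg hφ hc hθ).trans_eq (integral_congr_ae ?_)
  filter_upwards [ae_div_notMem (countable_sigmaLow G lam rho)] with p hp
  rw [(hh.isTiltMin_iff hlt hGI hp).1 (hκ _), entropyFlux_congr hGg (hsub (hm _))]

theorem Ishc.unique (hG : LipschitzOnWith L G (densities K))
    (hlam : lam ∈ densities K) (hrho : rho ∈ densities K) (hlt : lam < rho)
    (hh : Ishc G lam rho h) {w : ℝ → ℝ → ℝ} (hw : IsEntropySolution K G w)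
    (hw0 : HasInitialDatum w (riemannDatum lam rho)) :
    ∀ᵐ p ∂((volume : Measure (ℝ × ℝ)).restrict halfPlane), w p.1 p.2 = h (p.1 / p.2) := by
  have hsub := Icc_subset_densities (K := K) hlam.1 hrho
  have hGI := hG.mono hsub
  have hm := hh.mem hlt
  have hhm := (hh.monotone hlt).measurable
  obtain ⟨g, hg, hGg⟩ := hG.extend_real
  choose κ hκ using fun v => exists_isTiltMin hlt.le hGI.continuousOn v
  have hκg : ∀ v, IsTiltMin g lam rho v (κ v) := fun v => ⟨(hκ v).1, fun s hs => by
    rw [← hGg (hsub (hκ v).1), ← hGg (hsub hs)]; exact (hκ v).2 s hs⟩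
  obtain ⟨M, hM⟩ := hw.bounded
  -- `w` extended by `0` for `t ≤ 0`
  let W : ℝ × ℝ → ℝ := fun p => if 0 < p.2 then w p.1 p.2 else 0
  have hWw : ∀ p ∈ halfPlane, W p = w p.1 p.2 := fun p hp => if_pos (mem_halfPlane.1 hp)
  have hWd : ∀ p ∈ halfPlane, W p ∈ densities K := fun p hp => by
    rw [hWw p hp]; exact hw.mem _ _ (mem_halfPlane.1 hp)
  have hM0 : 0 ≤ M := (hw.mem 0 1 one_pos).1.trans (hM 0 1 one_pos)
  have hW0 : ∀ p, 0 ≤ W p := fun p => by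
    by_cases hp : 0 < p.2
    · simp only [W, if_pos hp]; exact (hw.mem _ _ hp).1
    · simp only [W, if_neg hp]; exact le_rfl
  have hWM : ∀ p, W p ≤ M := fun p => by
    by_cases hp : 0 < p.2
    · simp only [W, if_pos hp]; exact hM _ _ hp
    · simp only [W, if_neg hp]; exact hM0
  have hWm : Measurable W := by
    have hS : MeasurableSet {p : ℝ × ℝ | 0 < p.2} :=
      measurableSet_lt measurable_const measurable_snd
    refine measurable_of_restrict_of_restrict_compl hS ?_ ?_
    · have e : {p : ℝ × ℝ | 0 < p.2}.domRestrict W = (fun p : ℝ × Ioi (0 : ℝ) => w p.1 p.2) ∘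
          fun p : {p : ℝ × ℝ | 0 < p.2} => (p.1.1, ⟨p.1.2, p.2⟩) := by
        ext p
        exact if_pos p.2
      rw [e]
      exact hw.borel.comp ((measurable_fst.comp measurable_subtype_coe).prodMk
        ((measurable_snd.comp measurable_subtype_coe).subtype_mk))
    · have e : {p : ℝ × ℝ | 0 < p.2}ᶜ.domRestrict W = fun _ => 0 := by
        ext p
        exact if_neg p.2
      rw [e]
      exact measurable_const
  -- the Kruzhkov entropies of `w`, their fluxes normalized to vanish at `k`
  have hkr : ∀ k ∈ Icc lam rho, ∀ θ, IsTestFunction θ → 0 ≤ ∫ p in halfPlane,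
      (|W p - k| * fderiv ℝ θ p (0, 1) +
        (g (max (W p) k) - g (min (W p) k)) * fderiv ℝ θ p (1, 0)) := by
    intro k hk θ hθ
    have hcv : ConvexOn ℝ (densities K) fun r => |r - k| := by
      have hd : Convex ℝ (densities K) := by
        refine Set.OrdConnected.convex ⟨fun x hx y hy => Icc_subset_densities hx.1 hy⟩
      have h1 : ConvexOn ℝ univ fun r : ℝ => |r - k| := by
        simpa [Real.dist_eq] using convexOn_univ_dist k
      exact h1.subset (subset_univ _) hd
    have hd := hw.dissipative (fun r => |r - k|) hcv (by fun_prop) θ hθ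
    have hi1 : IntegrableOn (fun p => |W p - k| * fderiv ℝ θ p (0, 1)) halfPlane :=
      integrableOn_mul_of_bounded (C := M + rho) (hWm.sub_const k).abs (fun p _ => by
        rw [abs_abs]
        exact abs_le.2 ⟨by linarith [hW0 p, hk.2], by linarith [hWM p, hk.1, hlam.1]⟩)
        (hθ.integrable_fderiv _)
    have hi2 : IntegrableOn (fun p => (g (max (W p) k) - g (min (W p) k)) *
        fderiv ℝ θ p (1, 0)) halfPlane :=
      integrableOn_mul_of_bounded (C := L * (M + rho))
        ((hg.continuous.measurable.comp (hWm.max measurable_const)).sub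
          (hg.continuous.measurable.comp (hWm.min measurable_const)))
        (fun p _ => (abs_flux_diff_le hg _ _).trans (mul_le_mul_of_nonneg_left
          (abs_le.2 ⟨by linarith [hW0 p, hk.2], by linarith [hWM p, hk.1, hlam.1]⟩)
          L.coe_nonneg)) (hθ.integrable_fderiv _)
    have hi3 : IntegrableOn (fun p => (g 0 - g k) * fderiv ℝ θ p (1, 0)) halfPlane :=
      ((hθ.integrable_fderiv _).const_mul _).integrableOn
    have hadd := integral_add (hi1.add hi2) hi3
    rw [integral_const_mul, hθ.integral_fderiv, mul_zero, add_zero] at hadd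
    refine (hd.trans_eq ?_).trans_eq hadd
    refine setIntegral_congr_fun measurableSet_halfPlane fun p hp => ?_
    simp only [Pi.add_apply]
    rw [← hWw p hp, entropyFlux_congr hGg (hWd p hp),
      entropyFlux_abs hg (hlam.1.trans hk.1) (hW0 p)]
    ring
  -- the distance between `w` and the fan, and its flux
  let e : ℝ × ℝ → ℝ := fun p => |W p - h (p.1 / p.2)|
  let q : ℝ × ℝ → ℝ := fun p =>
    g (max (W p) (h (p.1 / p.2))) - g (min (W p) (h (p.1 / p.2)))
  have hhm' : Measurable fun p : ℝ × ℝ => h (p.1 / p.2) :=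
    hhm.comp (measurable_fst.div measurable_snd)
  have hzero := ae_eq_zero_of_dissipated (e := e) (q := q) (C := M + rho) (ℓ := L) L.coe_nonneg
    (hWm.sub hhm').abs ((hg.continuous.measurable.comp (hWm.max hhm')).sub
      (hg.continuous.measurable.comp (hWm.min hhm'))) (fun p => abs_nonneg _)
    (fun p => abs_le.2 ⟨by linarith [hW0 p, (hm (p.1 / p.2)).2],
      by linarith [hWM p, (hm (p.1 / p.2)).1, hlam.1, hlt]⟩)
    (fun p => abs_flux_diff_le hg _ _) (fun θ hθ => ?_) (fun a b => ?_)
  · filter_upwards [hzero, ae_restrict_mem measurableSet_halfPlane] with p hp hpH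
    rw [← hWw p hpH]
    exact sub_eq_zero.1 (abs_eq_zero.1 hp)
  · refine (kato_fan hg hlam.1 hlt.le hκg hWm hW0 hWM hkr hθ).trans_eq (integral_congr_ae ?_)
    filter_upwards [ae_div_notMem (countable_sigmaLow G lam rho)] with p hp
    rw [(hh.isTiltMin_iff hlt hGI hp).1 (hκ _)]
  · have hsum := (hw0 a b).add (hh.hasInitialDatum hGI hlt a b)
    rw [add_zero] at hsum
    refine squeeze_zero' (Eventually.of_forall fun t => integral_nonneg fun x => abs_nonneg _) ?_
      hsum
    filter_upwards [self_mem_nhdsWithin] with t ht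
    have ht : 0 < t := ht
    have hRm : Measurable (riemannDatum lam rho) :=
      Measurable.ite measurableSet_Iio measurable_const measurable_const
    have hR : ∀ x, riemannDatum lam rho x ∈ Icc lam rho := fun x => by
      unfold riemannDatum
      split_ifs
      exacts [left_mem_Icc.2 hlt.le, right_mem_Icc.2 hlt.le]
    have hWt : ∀ x, W (x, t) = w x t := fun x => if_pos ht
    have hwt : Measurable fun x => w x t := by
      have := hWm.comp (measurable_id.prodMk measurable_const : Measurable fun x : ℝ => (x, t))
      simpa only [Function.comp_def, id, hWt] using this
    have hht : Measurable fun x => h (x / t) := hhm.comp (measurable_id.div_const t)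
    have hint : ∀ {f : ℝ → ℝ}, Measurable f → (∀ x, f x ∈ Icc 0 (max M rho)) →
        IntegrableOn f (Icc a b) := fun {f} hf hfb =>
      Measure.integrableOn_of_bounded (M := max M rho) measure_Icc_lt_top.ne
        hf.aestronglyMeasurable (Eventually.of_forall fun x => by
          rw [Real.norm_eq_abs, abs_of_nonneg (hfb x).1]; exact (hfb x).2)
    have hwi := hint hwt fun x => ⟨(hw.mem x t ht).1, (hM x t ht).trans (le_max_left _ _)⟩
    have hhi := hint hht fun x => ⟨hlam.1.trans (hm _).1, (hm _).2.trans (le_max_right _ _)⟩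
    have hRi := hint hRm fun x => ⟨hlam.1.trans (hR x).1, (hR x).2.trans (le_max_right _ _)⟩
    have hi1 : IntegrableOn (fun x => |w x t - riemannDatum lam rho x|) (Icc a b) :=
      (hwi.sub hRi).abs
    have hi2 : IntegrableOn (fun x => |h (x / t) - riemannDatum lam rho x|) (Icc a b) :=
      (hhi.sub hRi).abs
    rw [← integral_add hi1 hi2]
    refine setIntegral_mono_on ?_ (hi1.add hi2) measurableSet_Icc fun x _ => ?_
    · simp only [e, hWt]
      exact (hwi.sub hhi).abs
    · simp only [e, hWt]
      rw [abs_sub_comm (h (x / t))]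
      exact abs_sub_le _ _ _

end Riemann

end ScalarLaw

end

theorem proposition4p2 (K : EReal) (G : ℝ → ℝ) (L : ℝ≥0)
    (hG : LipschitzOnWith L G (ScalarLaw.densities K))
    (R : Set ℝ) (hR : ScalarLaw.IsAffineOnGaps K G R)
    (lam rho : ℝ) (hlam : lam ∈ ScalarLaw.densities K) (hrho : rho ∈ ScalarLaw.densities K)
    (hlt : lam < rho) :
    (ScalarLaw.sigmaLow G lam rho).Countable ∧
    (∃ h, ScalarLaw.Ishc G lam rho h) ∧
    -- restricting the minimum to `R`
    (lam ∈ R → rho ∈ R → ∀ v : ℝ,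
      IsLeast ((fun r => G r - v * r) '' (Icc lam rho ∩ R)) (ScalarLaw.curlyG G v lam rho)) ∧
    ∀ h : ℝ → ℝ, ScalarLaw.Ishc G lam rho h →
      -- off `Σ_low(G)` the infimum is attained at `h v` and only there
      (∀ v : ℝ, v ∉ ScalarLaw.sigmaLow G lam rho →
        h v ∈ Icc lam rho ∧ G (h v) - v * h v = ScalarLaw.curlyG G v lam rho ∧
        ∀ r ∈ Icc lam rho, G r - v * r = ScalarLaw.curlyG G v lam rho → r = h v) ∧
      -- `h (x / t)` is the entropy solution of the Riemann problem
      ScalarLaw.IsTheEntropySolution K G (ScalarLaw.riemannDatum lam rho)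
        (fun x t => h (x / t)) ∧
      -- it is almost everywhere `R`-valued if `lam` and `rho` are in `R`
      (lam ∈ R → rho ∈ R →
        ∀ᵐ p ∂((volume : Measure (ℝ × ℝ)).restrict ScalarLaw.halfPlane), h (p.1 / p.2) ∈ R) ∧
      -- the mass between `v` and `w` at time `t`
      (∀ v w t : ℝ, 0 < t → ∫ x in v..w, h (x / t) =
        t * (ScalarLaw.curlyG G (v / t) lam rho - ScalarLaw.curlyG G (w / t) lam rho)) := by
  have hGI := hG.mono (ScalarLaw.Icc_subset_densities hlam.1 hrho)
  refine ⟨ScalarLaw.countable_sigmaLow G lam rho, ScalarLaw.exists_Ishc hlt hGI, ?_, fun h hh => ?_⟩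
  · intro hlR hrR v
    obtain ⟨r, hrR', hr⟩ :=
      ScalarLaw.exists_isTiltMin_mem hGI.continuousOn hlam hrho hlt.le hR hlR hrR v
    rw [hr.curlyG_eq]
    refine ⟨⟨r, ⟨hr.1, hrR'⟩, rfl⟩, ?_⟩
    rintro _ ⟨s, hs, rfl⟩
    exact hr.2 s hs.1
  have hmin := fun v (hv : v ∉ ScalarLaw.sigmaLow G lam rho) =>
    (hh.isTiltMin_iff hlt hGI hv).2 rfl
  refine ⟨fun v hv => ⟨(hmin v hv).1, (hmin v hv).curlyG_eq.symm, fun r hr hrv => ?_⟩,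
    ⟨⟨hh.isEntropySolution hG hlam hrho hlt, hh.hasInitialDatum hGI hlt⟩,
      fun w hw hw0 => hh.unique hG hlam hrho hlt hw hw0⟩, fun hlR hrR => ?_, fun v w t ht => ?_⟩
  · refine (hh.isTiltMin_iff hlt hGI hv).1 ⟨hr, fun s hs => ?_⟩
    rw [hrv, (hmin v hv).curlyG_eq]
    exact (hmin v hv).2 s hs
  · filter_upwards [ScalarLaw.ae_div_notMem (ScalarLaw.countable_sigmaLow G lam rho)] with p hp
    obtain ⟨r, hrR', hr⟩ :=
      ScalarLaw.exists_isTiltMin_mem hGI.continuousOn hlam hrho hlt.le hR hlR hrR (p.1 / p.2)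
    exact (hh.isTiltMin_iff hlt hGI hp).1 hr ▸ hrR'
  · choose κ hκ using fun v => ScalarLaw.exists_isTiltMin hlt.le hGI.continuousOn v
    rw [intervalIntegral.integral_comp_div _ ht.ne', smul_eq_mul,
      ← ScalarLaw.integral_selection hlt.le hGI.continuousOn hκ]
    congr 1
    refine intervalIntegral.integral_congr_ae ?_
    filter_upwards [(ScalarLaw.countable_sigmaLow G lam rho).ae_notMem volume] with x hx _
    exact ((hh.isTiltMin_iff hlt hGI hx).1 (hκ x)).symm
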